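/- Let $n_x\ge 1$, $n_w,n_z\ge 0$, and let $x\in\mathbb R^{n_x}$, $w\in\mathbb R^{n_w}$, $z\in\mathbb R^{n_z}$ be jointly Gaussian random vectors with zero mean and positive-definite joint covariance matrix. Write $V_{ab}=\mathbb E\{ab^\top\}$. Fix $\delta\ge 0$. **The game.** A sender observes a random element $o$ from which $(x,w)$ can be measurably recovered (for instance $o=(x,w)$, or $o=(x,w,z)$ if the sender also has access to $z$) and draws a scalar message $y\in\mathbb R$ from $\gamma(\cdot\mid o)$. A receiver draws $\hat x\in\mathbb R^{n_x}$ from $\psi(\cdot\mid y,z)$, and a malicious agent draws $\hat w\in\mathbb R^{n_w}$ from $\phi(\cdot\mid y,z)$. Let $\Gamma,\Psi,\Phi$ be the sets of all such conditional probability distributions (Markov kernels, so that deterministic policies are included), and let $\Psi^\Gamma,\Phi^\Gamma$ be the sets of all maps from $\Gamma$ to $\Psi$ and to $\Phi$. Let $A(\gamma,\psi)=\mathbb E\|x-\hat x\|_2^2$ and $B(\gamma,\phi)=\mathbb E\|w-\hat w\|_2^2$ be the errors under these policies. A triple $(\psi^*,\phi^*,\gamma^*)\in\Psi^\Gamma\times\Phi^\Gamma\times\Gamma$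 is an *equilibrium* if $A(\gamma^*,\psi^*(\gamma^*))$ and $B(\gamma^*,\phi^*(\gamma^*))$ are finite, $\psi^*$ minimizes $A(\gamma^*,\psi(\gamma^*))$ over $\psi\in\Psi^\Gamma$, $\phi^*$ minimizes $B(\gamma^*,\phi(\gamma^*))$ over $\phi\in\Phi^\Gamma$, and $\gamma^*$ minimizes $A(\gamma,\psi^*(\gamma))-\delta B(\gamma,\phi^*(\gamma))$ over $\gamma\in\Gamma$. **Claim.** Let $$\Xi=\begin{pmatrix}V_{xx}&V_{xw}\\V_{wx}&V_{ww}\end{pmatrix}-\begin{pmatrix}V_{xz}\\V_{wz}\end{pmatrix}V_{zz}^{-1}\begin{pmatrix}V_{xz}\\V_{wz}\end{pmatrix}^{\top}.$$ The matrix $\Xi^{1/2}\,\mathrm{diag}(-I,\delta I)\,\Xi^{1/2}$ has a smallest eigenvalue, and for every unit eigenvector $\xi$ belonging to it there is an equilibrium $(\psi^*,\phi^*,\gamma^*)$ such that 1. for every $\gamma\in\Gamma$, the policies $\psi^*(\gamma)$ and $\phi^*(\gamma)$ are the linear minimum mean square error estimators for the message $y$ generated by $\gamma$: almost surely $$\hat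 x=\begin{pmatrix}V_{xy}&V_{xz}\end{pmatrix}\begin{pmatrix}V_{yy}&V_{yz}\\V_{zy}&V_{zz}\end{pmatrix}^{-1}\begin{pmatrix}y\\z\end{pmatrix},\qquad \hat w=\begin{pmatrix}V_{wy}&V_{wz}\end{pmatrix}\begin{pmatrix}V_{yy}&V_{yz}\\V_{zy}&V_{zz}\end{pmatrix}^{-1}\begin{pmatrix}y\\z\end{pmatrix}$$ if $\mathbb E y^2<\infty$ and the inverse exists, and $\hat x=V_{xz}V_{zz}^{-1}z$, $\hat w=V_{wz}V_{zz}^{-1}z$ otherwise; 2. under $\gamma^*$, $\mathbb E y^2<\infty$ and the inverse in 1 exists, and $\mathbb P\{y=K_x^\top x+K_w^\top w\}=1$, where $\begin{pmatrix}K_x\\K_w\end{pmatrix}=\Xi^{-1/2}\xi$; 3. for every real $\kappa\neq 0$, $(\psi^*,\phi^*,\kappa\gamma^*)$ is also an equilibrium, where $\kappa\gamma^*$ sends $\kappa y$ whenever $\gamma^*$ sends $y$. -/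

import Mathlib

open MeasureTheory ProbabilityTheory
open scoped ENNReal MatrixOrder

noncomputable section

namespace PrivacyGame

/-- Column vectors `ℝⁿ` with the Euclidean norm. -/
abbrev Vec (n : ℕ) : Type := EuclideanSpace ℝ (Fin n)

/-- A randomized policy: a conditional probability distribution on `B` given a point of `A`.
Point masses (deterministic policies) are included. -/
abbrev Policy (A B : Type*) [MeasurableSpace A] [MeasurableSpace B] : Type _ :=
  {κ : Kernel A B // IsMarkovKernel κ}

/-! ### The game

`x` is the state, `w` the private information, `z` the side information, `o` what the sender
observes. The sender draws its message `y` from `γ (o)`; the receiver draws `x̂` from `ψ (y, z)` and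
the malicious agent draws `ŵ` from `φ (y, z)`. -/

section Game

variable {Ω I Y : Type*} [MeasurableSpace Ω] [MeasurableSpace I] [MeasurableSpace Y]
variable {nx nw nz : ℕ}

/-- The estimation error `E ‖v - v̂‖²`, in `[0, ∞]`, of an agent that estimates the random vector `v`
by `v̂ ~ e (· | y, z)` from a message `y ~ γ (· | o)` and the side information `z`. -/
def estError {n : ℕ} (P : Measure Ω) (v : Ω → Vec n) (z : Ω → Vec nz) (o : Ω → I)
    (γ : Policy I Y) (e : Policy (Y × Vec nz) (Vec n)) : ℝ≥0∞ :=
  ∫⁻ ω, ∫⁻ y, ∫⁻ vh, ‖v ω - vh‖ₑ ^ 2 ∂(e.1 (y, z ω)) ∂(γ.1 (o ω)) ∂P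

/-- The cost of the sender, `E ‖x - x̂‖² - δ E ‖w - ŵ‖²`. -/
def senderCost (P : Measure Ω) (x : Ω → Vec nx) (w : Ω → Vec nw) (z : Ω → Vec nz) (o : Ω → I)
    (δ : ℝ) (γ : Policy I Y) (e : Policy (Y × Vec nz) (Vec nx))
    (f : Policy (Y × Vec nz) (Vec nw)) : EReal :=
  (estError P x z o γ e : EReal) - (δ : EReal) * (estError P w z o γ f : EReal)

/-- Equilibrium of the privacy game with privacy ratio `δ`. The receiver and the malicious agent
choose maps from sender policies to estimation policies. The costs at the equilibrium are
finite, so that the cost of the sender there is a genuine difference. -/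
structure IsEquilibrium (P : Measure Ω) (x : Ω → Vec nx) (w : Ω → Vec nw) (z : Ω → Vec nz)
    (o : Ω → I) (δ : ℝ) (ψ : Policy I Y → Policy (Y × Vec nz) (Vec nx))
    (φ : Policy I Y → Policy (Y × Vec nz) (Vec nw)) (γ : Policy I Y) : Prop where
  finite_receiver : estError P x z o γ (ψ γ) ≠ ∞
  finite_malicious : estError P w z o γ (φ γ) ≠ ∞
  receiver : ∀ ψ' : Policy I Y → Policy (Y × Vec nz) (Vec nx),
    estError P x z o γ (ψ γ) ≤ estError P x z o γ (ψ' γ)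
  malicious : ∀ φ' : Policy I Y → Policy (Y × Vec nz) (Vec nw),
    estError P w z o γ (φ γ) ≤ estError P w z o γ (φ' γ)
  sender : ∀ γ' : Policy I Y,
    senderCost P x w z o δ γ (ψ γ) (φ γ) ≤ senderCost P x w z o δ γ' (ψ γ') (φ γ')

/-- The policy that sends `k * y` whenever `γ` sends `y`. -/
def scale (k : ℝ) (γ : Policy I ℝ) : Policy I ℝ :=
  ⟨γ.1.map (fun y => k * y),
    haveI := γ.2
    Kernel.IsMarkovKernel.map γ.1 (measurable_const_mul k)⟩

end Game

/-! ### Second moments and linear estimators -/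

section Moments

variable {Ω I : Type*} [MeasurableSpace Ω] [MeasurableSpace I]

/-- The matrix `V_{fg} = E (f gᵀ)` of two random vectors. -/
def secondMoment {ι κ : Type*} (P : Measure Ω) (f : Ω → ι → ℝ) (g : Ω → κ → ℝ) : Matrix ι κ ℝ :=
  Matrix.of fun i j => ∫ ω, f ω i * g ω j ∂P

/-- The stacked vector `(x, w)`. -/
def stackXW {nx nw : ℕ} (x : Ω → Vec nx) (w : Ω → Vec nw) (ω : Ω) : Fin nx ⊕ Fin nw → ℝ :=
  Sum.elim (x ω) (w ω)

/-- The stacked vector `(x, w, z)`. -/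
def stackXWZ {nx nw nz : ℕ} (x : Ω → Vec nx) (w : Ω → Vec nw) (z : Ω → Vec nz) (ω : Ω) :
    (Fin nx ⊕ Fin nw) ⊕ Fin nz → ℝ :=
  Sum.elim (stackXW x w ω) (z ω)

/-- The stacked vector `(y, z)` of a scalar message and the side information. -/
def stackYZ {nz : ℕ} (y : ℝ) (z : Vec nz) : Unit ⊕ Fin nz → ℝ :=
  Sum.elim (fun _ => y) z

/-- The expectation of `f (ω, y)` when the message is `y ~ γ (· | o)`. -/
def msgExpect (P : Measure Ω) (o : Ω → I) (γ : Policy I ℝ) (f : Ω → ℝ → ℝ) : ℝ :=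
  ∫ ω, ∫ y, f ω y ∂(γ.1 (o ω)) ∂P

/-- The matrix `[V_yy, V_yz; V_zy, V_zz]`. -/
def obsMoment {nz : ℕ} (P : Measure Ω) (z : Ω → Vec nz) (o : Ω → I) (γ : Policy I ℝ) :
    Matrix (Unit ⊕ Fin nz) (Unit ⊕ Fin nz) ℝ :=
  Matrix.of fun i j => msgExpect P o γ fun ω y => stackYZ y (z ω) i * stackYZ y (z ω) j

/-- The matrix `[V_vy, V_vz]`. -/
def crossMoment {n nz : ℕ} (P : Measure Ω) (v : Ω → Vec n) (z : Ω → Vec nz) (o : Ω → I)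
    (γ : Policy I ℝ) : Matrix (Fin n) (Unit ⊕ Fin nz) ℝ :=
  Matrix.of fun i j => msgExpect P o γ fun ω y => v ω i * stackYZ y (z ω) j

/-- `E y² < ∞` and `[V_yy, V_yz; V_zy, V_zz]` is invertible. -/
def IsRegular {nz : ℕ} (P : Measure Ω) (z : Ω → Vec nz) (o : Ω → I) (γ : Policy I ℝ) : Prop :=
  ∫⁻ ω, ∫⁻ y, ‖y‖ₑ ^ 2 ∂(γ.1 (o ω)) ∂P ≠ ∞ ∧ IsUnit (obsMoment P z o γ).det

open Classical in
/-- The linear minimum mean square error estimate of `v` from `(y, z)`, when the sender uses `γ`: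
`[V_vy, V_vz] [V_yy, V_yz; V_zy, V_zz]⁻¹ (y, z)`.
If `E y² = ∞` (a linear estimator of finite error cannot use `y`) or the inverse does not exist
(`y` is a linear function of `z`), the best linear estimate is `V_vz V_zz⁻¹ z`. -/
def lmmse {n nz : ℕ} (P : Measure Ω) (v : Ω → Vec n) (z : Ω → Vec nz) (o : Ω → I)
    (γ : Policy I ℝ) (q : ℝ × Vec nz) : Vec n :=
  if IsRegular P z o γ then
    WithLp.toLp 2 ((crossMoment P v z o γ * (obsMoment P z o γ)⁻¹).mulVec (stackYZ q.1 q.2))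
  else
    WithLp.toLp 2 ((secondMoment P (fun ω => (v ω).ofLp) (fun ω => (z ω).ofLp) *
      (secondMoment P (fun ω => (z ω).ofLp) (fun ω => (z ω).ofLp))⁻¹).mulVec q.2.ofLp)

/-- The matrix
`Ξ = [V_xx, V_xw; V_wx, V_ww] - [V_xz; V_wz] V_zz⁻¹ [V_xz; V_wz]ᵀ`. -/
def Xi {nx nw nz : ℕ} (P : Measure Ω) (x : Ω → Vec nx) (w : Ω → Vec nw) (z : Ω → Vec nz) :
    Matrix (Fin nx ⊕ Fin nw) (Fin nx ⊕ Fin nw) ℝ :=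
  secondMoment P (stackXW x w) (stackXW x w) -
    secondMoment P (stackXW x w) (fun ω => (z ω).ofLp) *
      (secondMoment P (fun ω => (z ω).ofLp) (fun ω => (z ω).ofLp))⁻¹ *
      (secondMoment P (stackXW x w) (fun ω => (z ω).ofLp)).transpose

end Moments

/-- The matrix `S^{1/2} diag(-I, δ I) S^{1/2}`. -/
def privacyMatrix {nx nw : ℕ} (S : Matrix (Fin nx ⊕ Fin nw) (Fin nx ⊕ Fin nw) ℝ) (δ : ℝ) :
    Matrix (Fin nx ⊕ Fin nw) (Fin nx ⊕ Fin nw) ℝ :=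
  CFC.sqrt S *
    Matrix.fromBlocks (-1 : Matrix (Fin nx) (Fin nx) ℝ) 0 0 (δ • (1 : Matrix (Fin nw) (Fin nw) ℝ)) *
    CFC.sqrt S

/-- `ξ` has Euclidean norm one and is an eigenvector of `M` for the smallest eigenvalue of `M`. -/
def IsNormalizedMinEigenvector {ι : Type*} [Fintype ι] [DecidableEq ι] (M : Matrix ι ι ℝ)
    (ξ : ι → ℝ) : Prop :=
  ξ ⬝ᵥ ξ = 1 ∧ ∃ l : ℝ,
    IsLeast {m : ℝ | Module.End.HasEigenvalue (Matrix.toLin' M) m} l ∧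
    Module.End.HasEigenvector (Matrix.toLin' M) l ξ

end PrivacyGame

end

noncomputable section

namespace PrivacyGame

open Matrix

/-! ### Smallest eigenvalues of symmetric matrices -/

/-! Let `r` be the residual of `(x, w)` after regression on `z`; its covariance is `Ξ`. For a
message `y` of finite variance not explained by `z`, let `s > 0` be the variance of the residual of
`y` on `z` and `c` its covariance with `r`. Regression on `(y, z)` can be done in two steps, so each
component of a linear estimate has error `Ξ_ii - c_i² / s`. Against linear estimators the sender's
cost is therefore a constant (the cost of silence) plus `q(c) / s`, where `q` is the form of
`diag(-I, δI)`; messages on which the estimators ignore `y` cost exactly the constant.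

The joint covariance of `r` and the residual of `y` is positive semidefinite, so `cᵀ Ξ⁻¹ c ≤ s`.
Writing `c = Ξ^{1/2} a` gives `‖a‖² ≤ s` and `q(c) = aᵀ M a ≥ l ‖a‖²`, with `M` the privacy matrix
and `l` its smallest eigenvalue. Since `n_x ≥ 1`, `q` takes negative values, hence `l < 0` and `q(c)
/ s ≥ l`. No message, Gaussian or not, beats silence by more than `-l` (`le_senderCost`). The
message `Kᵀ(x, w)` with `K = Ξ^{-1/2} ξ` has `s = 1` and `c = Ξ^{1/2} ξ`, so it attains the bound;
scaling it by `κ` multiplies `q(c)` and `s` by the same `κ²`.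

The estimators only need to be optimal at `γ*`, because their equilibrium conditions compare errors
there alone. At `γ*` the message is linear in Gaussian vectors, so the regression residual is
independent of `(y, z)` and no estimator, nonlinear or randomized, improves on the linear one
(`estError_lmmsePolicy_le`). -/

theorem dotProduct_mulVec_comm {ι : Type*} [Fintype ι] {S : Matrix ι ι ℝ} (hS : S.IsHermitian)
    (a b : ι → ℝ) : a ⬝ᵥ S *ᵥ b = (S *ᵥ a) ⬝ᵥ b := by
  have : Sᵀ = S := by simpa [Matrix.IsHermitian] using hS
  rw [dotProduct_mulVec, ← mulVec_transpose, this]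

section Eigen

variable {ι : Type*} [Fintype ι] [DecidableEq ι]

theorem hasEigenvalue_eigenvalues {M : Matrix ι ι ℝ} (hM : M.IsHermitian) (i : ι) :
    Module.End.HasEigenvalue (Matrix.toLin' M) (hM.eigenvalues i) := by
  refine Module.End.hasEigenvalue_of_hasEigenvector
    (x := (hM.eigenvectorBasis i).ofLp) ⟨?_, ?_⟩
  · rw [Module.End.mem_eigenspace_iff, Matrix.toLin'_apply]
    exact hM.mulVec_eigenvectorBasis i
  · have h := hM.eigenvectorBasis.toBasis.ne_zero i
    intro h0
    apply h
    rw [OrthonormalBasis.coe_toBasis]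
    ext j
    exact congrFun h0 j

/-- An eigenvalue `m` of `M - l I` gives the eigenvalue `m + l ≥ l` of `M`, so `M - l I` is positive
semidefinite. -/
theorem mul_dotProduct_self_le {M : Matrix ι ι ℝ} (hM : M.IsHermitian) {l : ℝ}
    (hl : l ∈ lowerBounds {m : ℝ | Module.End.HasEigenvalue (Matrix.toLin' M) m}) (a : ι → ℝ) :
    l * (a ⬝ᵥ a) ≤ a ⬝ᵥ M *ᵥ a := by
  have hH : (M - l • (1 : Matrix ι ι ℝ)).IsHermitian :=
    hM.sub (by simp [Matrix.IsHermitian])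
  have hpos : (M - l • (1 : Matrix ι ι ℝ)).PosSemidef := by
    rw [hH.posSemidef_iff_eigenvalues_nonneg]
    intro i
    have h1 := hasEigenvalue_eigenvalues hH i
    obtain ⟨v, hv⟩ := h1.exists_hasEigenvector
    have h2 : Module.End.HasEigenvalue (Matrix.toLin' M) (hH.eigenvalues i + l) := by
      refine Module.End.hasEigenvalue_of_hasEigenvector (x := v) ⟨?_, hv.2⟩
      have := hv.apply_eq_smul
      rw [Matrix.toLin'_apply, Matrix.sub_mulVec, Matrix.smul_mulVec, Matrix.one_mulVec] at this
      rw [Module.End.mem_eigenspace_iff, Matrix.toLin'_apply, add_smul, ← this]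
      simp
    have := hl h2
    simp only [Pi.zero_apply]
    linarith
  have := hpos.dotProduct_mulVec_nonneg a
  rw [Matrix.sub_mulVec, Matrix.smul_mulVec, Matrix.one_mulVec, dotProduct_sub,
    dotProduct_smul] at this
  simp only [star_trivial, smul_eq_mul] at this
  linarith

theorem exists_isNormalizedMinEigenvector [Nonempty ι] {M : Matrix ι ι ℝ} (hM : M.IsHermitian) :
    ∃ ξ, IsNormalizedMinEigenvector M ξ := by
  have hfin : {m : ℝ | Module.End.HasEigenvalue (Matrix.toLin' M) m}.Finite :=
    Module.End.finite_hasEigenvalue _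
  obtain ⟨l, hl⟩ := hfin.exists_minimal ⟨_, hasEigenvalue_eigenvalues hM (Classical.arbitrary ι)⟩
  have hleast : IsLeast {m : ℝ | Module.End.HasEigenvalue (Matrix.toLin' M) m} l :=
    ⟨hl.1, fun m hm => (le_total l m).elim id fun h => hl.2 hm h⟩
  obtain ⟨v, hv⟩ := hleast.1.exists_hasEigenvector
  have hpos : 0 < v ⬝ᵥ v :=
    lt_of_le_of_ne (by simpa using dotProduct_star_self_nonneg v)
      fun h => hv.2 (dotProduct_self_eq_zero.1 h.symm)
  refine ⟨(Real.sqrt (v ⬝ᵥ v))⁻¹ • v, ?_, l, hleast, ?_, ?_⟩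
  · rw [smul_dotProduct, dotProduct_smul, smul_eq_mul, smul_eq_mul, ← mul_assoc, ← mul_inv,
      Real.mul_self_sqrt hpos.le, inv_mul_cancel₀ hpos.ne']
  · exact Submodule.smul_mem _ _ hv.1
  · exact smul_ne_zero (inv_ne_zero (Real.sqrt_ne_zero'.2 hpos)) hv.2

theorem isHermitian_sqrt (S : Matrix ι ι ℝ) : (CFC.sqrt S).IsHermitian :=
  (Matrix.nonneg_iff_posSemidef.1 (CFC.sqrt_nonneg S)).isHermitian

theorem sqrt_mul_sqrt {S : Matrix ι ι ℝ} (hS : S.PosDef) : CFC.sqrt S * CFC.sqrt S = S :=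
  CFC.sqrt_mul_sqrt_self S (Matrix.nonneg_iff_posSemidef.2 hS.posSemidef)

theorem isUnit_det_sqrt {S : Matrix ι ι ℝ} (hS : S.PosDef) : IsUnit (CFC.sqrt S).det := by
  have h : (CFC.sqrt S).det * (CFC.sqrt S).det = S.det := by rw [← det_mul, sqrt_mul_sqrt hS]
  refine isUnit_iff_ne_zero.2 fun h0 => hS.det_pos.ne' ?_
  rw [← h, h0, zero_mul]

end Eigen

/-! ### The privacy matrix and its quadratic form. -/

section PrivacyMatrix

variable {nx nw : ℕ}

/-- The quadratic form of `diag(-I, δ I)`. -/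
def privacyForm (δ : ℝ) (c : Fin nx ⊕ Fin nw → ℝ) : ℝ :=
  -(∑ i, c (Sum.inl i) ^ 2) + δ * ∑ j, c (Sum.inr j) ^ 2

theorem dotProduct_fromBlocks_mulVec (δ : ℝ) (c : Fin nx ⊕ Fin nw → ℝ) :
    c ⬝ᵥ Matrix.fromBlocks (-1 : Matrix (Fin nx) (Fin nx) ℝ) 0 0
      (δ • (1 : Matrix (Fin nw) (Fin nw) ℝ)) *ᵥ c = privacyForm δ c := by
  rw [fromBlocks_mulVec]
  simp [dotProduct, privacyForm, neg_mulVec, smul_mulVec, Finset.mul_sum, pow_two, mul_left_comm]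

theorem isHermitian_privacyMatrix (S : Matrix (Fin nx ⊕ Fin nw) (Fin nx ⊕ Fin nw) ℝ) (δ : ℝ) :
    (privacyMatrix S δ).IsHermitian := by
  have h := isHermitian_sqrt S
  unfold privacyMatrix
  rw [Matrix.IsHermitian, conjTranspose_mul, conjTranspose_mul, h.eq, fromBlocks_conjTranspose,
    Matrix.mul_assoc]
  simp

theorem dotProduct_privacyMatrix_mulVec (S : Matrix (Fin nx ⊕ Fin nw) (Fin nx ⊕ Fin nw) ℝ) (δ : ℝ)
    (a : Fin nx ⊕ Fin nw → ℝ) :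
    a ⬝ᵥ privacyMatrix S δ *ᵥ a = privacyForm δ (CFC.sqrt S *ᵥ a) := by
  rw [← dotProduct_fromBlocks_mulVec, privacyMatrix, ← mulVec_mulVec, ← mulVec_mulVec,
    dotProduct_mulVec_comm (isHermitian_sqrt S)]

variable {S : Matrix (Fin nx ⊕ Fin nw) (Fin nx ⊕ Fin nw) ℝ} {δ l : ℝ}

/-- The test vector `S^{-1/2} e`, with `e` a coordinate vector of the `x` block, has quadratic form
`-1`. -/
theorem minEigenvalue_privacyMatrix_neg (hnx : 0 < nx) (hS : S.PosDef)
    (hl : l ∈ lowerBounds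
      {m : ℝ | Module.End.HasEigenvalue (Matrix.toLin' (privacyMatrix S δ)) m}) : l < 0 := by
  set e : Fin nx ⊕ Fin nw → ℝ := Pi.single (Sum.inl ⟨0, hnx⟩) 1 with he
  have h := mul_dotProduct_self_le (isHermitian_privacyMatrix S δ) hl ((CFC.sqrt S)⁻¹ *ᵥ e)
  rw [dotProduct_privacyMatrix_mulVec, mulVec_mulVec, mul_nonsing_inv _ (isUnit_det_sqrt hS),
    one_mulVec] at h
  have h2 : privacyForm δ e = -1 := by
    simp [privacyForm, he, Pi.single_apply]
  rw [h2] at h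
  by_contra hl0
  have : 0 ≤ ((CFC.sqrt S)⁻¹ *ᵥ e) ⬝ᵥ ((CFC.sqrt S)⁻¹ *ᵥ e) := by
    simpa using dotProduct_star_self_nonneg ((CFC.sqrt S)⁻¹ *ᵥ e)
  nlinarith [mul_nonneg (not_lt.1 hl0) this]

/-- The correlations `c` of a message residual of variance `s` with a vector of covariance `S`
satisfy `cᵀ S⁻¹ c ≤ s`, so the relative gain is at least the smallest eigenvalue. -/
theorem minEigenvalue_le_privacyForm_div (hnx : 0 < nx) (hS : S.PosDef)
    (hl : l ∈ lowerBounds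
      {m : ℝ | Module.End.HasEigenvalue (Matrix.toLin' (privacyMatrix S δ)) m})
    {c : Fin nx ⊕ Fin nw → ℝ} {s : ℝ} (hs : 0 < s)
    (hc : ∀ t : Fin nx ⊕ Fin nw → ℝ, ∀ α : ℝ,
      0 ≤ t ⬝ᵥ S *ᵥ t + 2 * α * (t ⬝ᵥ c) + α ^ 2 * s) :
    l ≤ privacyForm δ c / s := by
  have hR := isHermitian_sqrt S
  have hu := isUnit_det_sqrt hS
  set R := CFC.sqrt S with hRdef
  set a := R⁻¹ *ᵥ c with ha
  have hRa : R *ᵥ a = c := by rw [ha, mulVec_mulVec, mul_nonsing_inv _ hu, one_mulVec]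
  have hg0 : 0 ≤ a ⬝ᵥ a := by simpa using dotProduct_star_self_nonneg a
  have h1 := mul_dotProduct_self_le (isHermitian_privacyMatrix S δ) hl a
  rw [dotProduct_privacyMatrix_mulVec, ← hRdef, hRa] at h1
  -- Here `t = S⁻¹ c`, and `α` is the minimizer of the quadratic `g + 2αg + α²s`, where `g = a ⬝ᵥ a
  -- = cᵀ S⁻¹ c`. The minimum is `g (s - g) / s`, which forces `g ≤ s`.
  have h2 := hc (R⁻¹ *ᵥ a) (-(a ⬝ᵥ a) / s)
  have h3 : (R⁻¹ *ᵥ a) ⬝ᵥ c = a ⬝ᵥ a := by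
    rw [← hRa, dotProduct_mulVec_comm hR, mulVec_mulVec, mul_nonsing_inv _ hu, one_mulVec]
  have h4 : (R⁻¹ *ᵥ a) ⬝ᵥ S *ᵥ (R⁻¹ *ᵥ a) = a ⬝ᵥ a := by
    rw [← sqrt_mul_sqrt hS, ← hRdef, ← mulVec_mulVec, mulVec_mulVec a, mul_nonsing_inv _ hu,
      one_mulVec, dotProduct_mulVec_comm hR, mulVec_mulVec, mul_nonsing_inv _ hu, one_mulVec]
  rw [h3, h4] at h2
  have h5 : a ⬝ᵥ a ≤ s := by
    have h6 : a ⬝ᵥ a + 2 * (-(a ⬝ᵥ a) / s) * (a ⬝ᵥ a) + (-(a ⬝ᵥ a) / s) ^ 2 * s =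
        (a ⬝ᵥ a) * (s - a ⬝ᵥ a) / s := by field_simp; ring
    rw [h6] at h2
    by_contra h7
    push Not at h7
    have h8 : 0 < a ⬝ᵥ a := hs.trans h7
    have : (a ⬝ᵥ a) * (s - a ⬝ᵥ a) / s < 0 :=
      div_neg_of_neg_of_pos (mul_neg_of_pos_of_neg h8 (by linarith)) hs
    linarith
  -- The sign of `l` is essential: `a ⬝ᵥ a ≤ s` yields `l * s ≤ l * (a ⬝ᵥ a)` because `l < 0`.
  have hl0 := minEigenvalue_privacyMatrix_neg hnx hS hl
  rw [le_div_iff₀ hs]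
  nlinarith

theorem privacyForm_sqrt_mulVec {ξ : Fin nx ⊕ Fin nw → ℝ} (h1 : ξ ⬝ᵥ ξ = 1)
    (hξ : Module.End.HasEigenvector (Matrix.toLin' (privacyMatrix S δ)) l ξ) :
    privacyForm δ (CFC.sqrt S *ᵥ ξ) = l := by
  have := hξ.apply_eq_smul
  rw [Matrix.toLin'_apply] at this
  rw [← dotProduct_privacyMatrix_mulVec, this, dotProduct_smul, h1, smul_eq_mul, mul_one]

end PrivacyMatrix

/-! ### Schur complements -/

section Schur

variable {ι κ : Type*} [Fintype ι] [Fintype κ] [DecidableEq ι] [DecidableEq κ]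

/-- Semidefiniteness passes to the Schur complement; definiteness follows since its determinant is a
factor of the nonzero determinant of the block matrix. -/
theorem posDef_schurComplement {A : Matrix ι ι ℝ} {B : Matrix ι κ ℝ} {D : Matrix κ κ ℝ}
    (h : (Matrix.fromBlocks A B Bᵀ D).PosDef) : (A - B * D⁻¹ * Bᵀ).PosDef := by
  have hD : D.PosDef := by
    have := h.submatrix (e := Sum.inr) Sum.inr_injective
    exact this
  have : Invertible D := D.invertibleOfIsUnitDet (isUnit_iff_ne_zero.2 hD.det_pos.ne')
  have hps : (A - B * D⁻¹ * Bᵀ).PosSemidef := by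
    have := h.posSemidef
    rw [← conjTranspose_eq_transpose_of_trivial, PosDef.fromBlocks₂₂ A B hD] at this
    simpa using this
  refine (hps.posDef_iff_isUnit).2 ((isUnit_iff_isUnit_det _).2 (isUnit_iff_ne_zero.2 ?_))
  intro h0
  refine h.det_pos.ne' ?_
  rw [det_fromBlocks₂₂, invOf_eq_nonsing_inv, h0, mul_zero]

end Schur

/-! ### Second moments of square integrable random vectors -/

section SecondMoment

variable {Ω : Type*} [MeasurableSpace Ω] {Q : Measure Ω} {ι κ τ : Type*}

theorem secondMoment_transpose (f : Ω → ι → ℝ) (g : Ω → κ → ℝ) :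
    (secondMoment Q f g)ᵀ = secondMoment Q g f := by
  ext i j
  simp [secondMoment, mul_comm]

theorem memLp_mulVec [Fintype κ] (A : Matrix ι κ ℝ) {g : Ω → κ → ℝ}
    (hg : ∀ j, MemLp (fun ω => g ω j) 2 Q) (i : ι) :
    MemLp (fun ω => (A *ᵥ g ω) i) 2 Q := by
  simp only [mulVec, dotProduct]
  exact memLp_finsetSum _ fun j _ => (hg j).const_mul _

theorem integral_add_mul_sq {f g : Ω → ℝ} (hf : MemLp f 2 Q) (hg : MemLp g 2 Q) (b : ℝ) :
    ∫ ω, (f ω + b * g ω) ^ 2 ∂Q =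
      ∫ ω, f ω ^ 2 ∂Q + 2 * b * ∫ ω, f ω * g ω ∂Q + b ^ 2 * ∫ ω, g ω ^ 2 ∂Q := by
  have i1 := hf.integrable_sq
  have i2 : Integrable (fun ω => 2 * b * (f ω * g ω)) Q := (hf.integrable_mul hg).const_mul _
  have i3 : Integrable (fun ω => b ^ 2 * g ω ^ 2) Q := hg.integrable_sq.const_mul _
  have i4 : Integrable (fun ω => f ω ^ 2 + 2 * b * (f ω * g ω)) Q := i1.add i2
  rw [← integral_const_mul, ← integral_const_mul, ← integral_add i1 i2, ← integral_add i4 i3]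
  refine integral_congr_ae (.of_forall fun ω => ?_)
  simp only
  ring

theorem secondMoment_sub_left {f f' : Ω → ι → ℝ} {g : Ω → κ → ℝ}
    (hf : ∀ j, MemLp (fun ω => f ω j) 2 Q) (hf' : ∀ j, MemLp (fun ω => f' ω j) 2 Q)
    (hg : ∀ j, MemLp (fun ω => g ω j) 2 Q) :
    secondMoment Q (fun ω => f ω - f' ω) g = secondMoment Q f g - secondMoment Q f' g := by
  ext i j
  simp only [secondMoment, of_apply, Matrix.sub_apply, Pi.sub_apply, sub_mul]
  exact integral_sub ((hf i).integrable_mul (hg j)) ((hf' i).integrable_mul (hg j))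

theorem secondMoment_sub_right {f : Ω → ι → ℝ} {g g' : Ω → κ → ℝ}
    (hf : ∀ j, MemLp (fun ω => f ω j) 2 Q) (hg : ∀ j, MemLp (fun ω => g ω j) 2 Q)
    (hg' : ∀ j, MemLp (fun ω => g' ω j) 2 Q) :
    secondMoment Q f (fun ω => g ω - g' ω) = secondMoment Q f g - secondMoment Q f g' := by
  rw [← secondMoment_transpose, secondMoment_sub_left hg hg' hf, transpose_sub,
    secondMoment_transpose, secondMoment_transpose]

theorem secondMoment_mulVec_left [Fintype κ] (A : Matrix ι κ ℝ) {f : Ω → κ → ℝ} {g : Ω → τ → ℝ}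
    (hf : ∀ j, MemLp (fun ω => f ω j) 2 Q) (hg : ∀ j, MemLp (fun ω => g ω j) 2 Q) :
    secondMoment Q (fun ω => A *ᵥ f ω) g = A * secondMoment Q f g := by
  ext i j
  simp only [secondMoment, of_apply, mul_apply, mulVec, dotProduct, Finset.sum_mul, mul_assoc]
  have h : ∀ k, Integrable (fun ω => A i k * (f ω k * g ω j)) Q := fun k =>
    ((hf k).integrable_mul (hg j)).const_mul _
  rw [integral_finsetSum _ fun k _ => h k]
  simp only [integral_const_mul]

theorem secondMoment_mulVec_right [Fintype κ] (A : Matrix ι κ ℝ) {f : Ω → κ → ℝ} {g : Ω → τ → ℝ}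
    (hf : ∀ j, MemLp (fun ω => f ω j) 2 Q) (hg : ∀ j, MemLp (fun ω => g ω j) 2 Q) :
    secondMoment Q g (fun ω => A *ᵥ f ω) = secondMoment Q g f * Aᵀ := by
  rw [← secondMoment_transpose, secondMoment_mulVec_left A hf hg, transpose_mul,
    secondMoment_transpose]

end SecondMoment

/-! ### Linear regression -/

section Residual

variable {Ω : Type*} [MeasurableSpace Ω] {Q : Measure Ω} {ι κ τ : Type*}
  [Fintype τ] [DecidableEq τ]

/-- The residual of the linear regression of `f` on `z`. -/
def residual (Q : Measure Ω) (f : Ω → ι → ℝ) (z : Ω → τ → ℝ) (ω : Ω) : ι → ℝ :=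
  f ω - (secondMoment Q f z * (secondMoment Q z z)⁻¹) *ᵥ z ω

variable {f : Ω → ι → ℝ} {g : Ω → κ → ℝ} {z : Ω → τ → ℝ}

theorem memLp_residual (hf : ∀ j, MemLp (fun ω => f ω j) 2 Q)
    (hz : ∀ j, MemLp (fun ω => z ω j) 2 Q) (i : ι) :
    MemLp (fun ω => residual Q f z ω i) 2 Q :=
  (hf i).sub (memLp_mulVec _ hz i)

/-- The normal equations: the residual is orthogonal to the regressors. -/
theorem secondMoment_residual_obs (hf : ∀ j, MemLp (fun ω => f ω j) 2 Q)
    (hz : ∀ j, MemLp (fun ω => z ω j) 2 Q) (hdet : IsUnit (secondMoment Q z z).det) :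
    secondMoment Q (residual Q f z) z = 0 := by
  unfold residual
  rw [secondMoment_sub_left hf (memLp_mulVec _ hz) hz, secondMoment_mulVec_left _ hz hz,
    Matrix.mul_assoc, nonsing_inv_mul _ hdet, Matrix.mul_one, sub_self]

/-- The two right-hand factors differ by a linear function of `z`, to which the residual of `f` is
orthogonal. -/
theorem secondMoment_residual_right (hf : ∀ j, MemLp (fun ω => f ω j) 2 Q)
    (hg : ∀ j, MemLp (fun ω => g ω j) 2 Q)
    (hz : ∀ j, MemLp (fun ω => z ω j) 2 Q) (hdet : IsUnit (secondMoment Q z z).det) :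
    secondMoment Q (residual Q f z) (residual Q g z) = secondMoment Q (residual Q f z) g := by
  have h : residual Q g z = fun ω => g ω -
    (secondMoment Q g z * (secondMoment Q z z)⁻¹) *ᵥ z ω := rfl
  rw [h, secondMoment_sub_right (memLp_residual hf hz) hg (memLp_mulVec _ hz),
    secondMoment_mulVec_right _ hz (memLp_residual hf hz), secondMoment_residual_obs hf hz hdet,
    Matrix.zero_mul, sub_zero]

theorem secondMoment_residual_left (hf : ∀ j, MemLp (fun ω => f ω j) 2 Q)
    (hg : ∀ j, MemLp (fun ω => g ω j) 2 Q) (hz : ∀ j, MemLp (fun ω => z ω j) 2 Q) :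
    secondMoment Q (residual Q f z) g = secondMoment Q f g -
      secondMoment Q f z * (secondMoment Q z z)⁻¹ * (secondMoment Q g z)ᵀ := by
  unfold residual
  rw [secondMoment_sub_left hf (memLp_mulVec _ hz) hg, secondMoment_mulVec_left _ hz hg,
    secondMoment_transpose]

end Residual

/-! ### Regression on a scalar message and side information -/

section Obs

variable {Ω : Type*} [MeasurableSpace Ω] {Q : Measure Ω} {τ : Type*} {y : Ω → ℝ} {z : Ω → τ → ℝ}

/-- The observation `(y, z)`. -/
def obs (y : Ω → ℝ) (z : Ω → τ → ℝ) (ω : Ω) : Unit ⊕ τ → ℝ := Sum.elim (fun _ => y ω) (z ω)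

theorem memLp_obs (hy : MemLp y 2 Q) (hz : ∀ j, MemLp (fun ω => z ω j) 2 Q) (j : Unit ⊕ τ) :
    MemLp (fun ω => obs y z ω j) 2 Q := by
  rcases j with j | j
  exacts [hy, hz j]

end Obs

section Message

variable {Ω : Type*} [MeasurableSpace Ω] {Q : Measure Ω} {ι τ : Type*} [Fintype τ] [DecidableEq τ]
  {v : Ω → ι → ℝ} {y : Ω → ℝ} {z : Ω → τ → ℝ}

/-- The variance of the part of the message `y` that is not explained by `z`. -/
def msgVar (Q : Measure Ω) (y : Ω → ℝ) (z : Ω → τ → ℝ) : ℝ :=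
  secondMoment Q (residual Q (fun ω (_ : Unit) => y ω) z) (fun ω (_ : Unit) => y ω) () ()

/-- The covariance of the parts of `v` and `y` that are not explained by `z`. -/
def msgCov (Q : Measure Ω) (v : Ω → ι → ℝ) (y : Ω → ℝ) (z : Ω → τ → ℝ) (i : ι) : ℝ :=
  secondMoment Q (residual Q v z) (fun ω (_ : Unit) => y ω) i ()

/-- `msgVar` is the Schur complement of the `z` block. Invertibility of the moment matrix of `(y,
z)` thus amounts to `msgVar ≠ 0`. -/
theorem det_secondMoment_obs (hy : MemLp y 2 Q) (hz : ∀ j, MemLp (fun ω => z ω j) 2 Q)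
    (hdet : IsUnit (secondMoment Q z z).det) :
    (secondMoment Q (obs y z) (obs y z)).det = (secondMoment Q z z).det * msgVar Q y z := by
  have hy' : ∀ j : Unit, MemLp (fun ω => (fun ω (_ : Unit) => y ω) ω j) 2 Q := fun _ => hy
  have hG : secondMoment Q (obs y z) (obs y z) =
      fromBlocks (secondMoment Q (fun ω (_ : Unit) => y ω) (fun ω (_ : Unit) => y ω))
        (secondMoment Q (fun ω (_ : Unit) => y ω) z)
        (secondMoment Q z (fun ω (_ : Unit) => y ω)) (secondMoment Q z z) := by
    ext i j
    rcases i with i | i <;> rcases j with j | j <;> rfl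
  have : Invertible (secondMoment Q z z) := invertibleOfIsUnitDet _ hdet
  rw [hG, det_fromBlocks₂₂, invOf_eq_nonsing_inv]
  congr 1
  rw [msgVar, secondMoment_residual_left hy' hy' hz, secondMoment_transpose, det_unique]

theorem msgVar_eq (hy : MemLp y 2 Q) (hz : ∀ j, MemLp (fun ω => z ω j) 2 Q)
    (hdet : IsUnit (secondMoment Q z z).det) :
    msgVar Q y z = ∫ ω, residual Q (fun ω (_ : Unit) => y ω) z ω () ^ 2 ∂Q := by
  have hy' : ∀ j : Unit, MemLp (fun ω => (fun ω (_ : Unit) => y ω) ω j) 2 Q := fun _ => hy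
  rw [msgVar, ← secondMoment_residual_right hy' hy' hz hdet]
  simp [secondMoment, pow_two]

theorem msgVar_nonneg (hy : MemLp y 2 Q) (hz : ∀ j, MemLp (fun ω => z ω j) 2 Q)
    (hdet : IsUnit (secondMoment Q z z).det) : 0 ≤ msgVar Q y z := by
  rw [msgVar_eq hy hz hdet]
  exact integral_nonneg fun _ => sq_nonneg _

/-- The expression is the second moment of `tᵀ r + α r_y`, with `r` and `r_y` the residuals of `v`
and `y` on `z`. This is the Cauchy–Schwarz input of the lower bound on the sender's cost. -/
theorem quadratic_residual_nonneg [Fintype ι] (hv : ∀ i, MemLp (fun ω => v ω i) 2 Q)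
    (hy : MemLp y 2 Q) (hz : ∀ j, MemLp (fun ω => z ω j) 2 Q)
    (hdet : IsUnit (secondMoment Q z z).det) (t : ι → ℝ) (α : ℝ) :
    0 ≤ t ⬝ᵥ secondMoment Q (residual Q v z) v *ᵥ t + 2 * α * (t ⬝ᵥ msgCov Q v y z) +
      α ^ 2 * msgVar Q y z := by
  have hy' : ∀ j : Unit, MemLp (fun ω => (fun ω (_ : Unit) => y ω) ω j) 2 Q := fun _ => hy
  set r := residual Q v z with hr
  set ry := residual Q (fun ω (_ : Unit) => y ω) z with hry
  have hrL := memLp_residual hv hz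
  have hryL := memLp_residual hy' hz
  have htr : MemLp (fun ω => t ⬝ᵥ r ω) 2 Q := by
    simp only [dotProduct]
    exact memLp_finsetSum _ fun j _ => (hrL j).const_mul _
  have h1 : ∫ ω, (t ⬝ᵥ r ω) ^ 2 ∂Q = t ⬝ᵥ secondMoment Q r v *ᵥ t := by
    rw [hr, ← secondMoment_residual_right hv hv hz hdet, ← hr]
    -- The scalar `tᵀ r` is treated as a vector with one entry, so that the matrix rules for second
    -- moments apply.
    have := secondMoment_mulVec_left (replicateRow Unit t) hrL
      (memLp_mulVec (replicateRow Unit t) hrL)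
    rw [secondMoment_mulVec_right _ hrL hrL] at this
    have := congrFun (congrFun this ()) ()
    rw [← Matrix.mul_assoc] at this
    calc _ = _ := by simp [pow_two]; exact this
      _ = _ := by
        simp [Matrix.mul_apply, dotProduct, mulVec, Finset.mul_sum, Finset.sum_mul, hr]
        rw [Finset.sum_comm]
        simp only [mul_assoc]
  have h2 : ∫ ω, (t ⬝ᵥ r ω) * ry ω () ∂Q = t ⬝ᵥ msgCov Q v y z := by
    have := secondMoment_mulVec_left (replicateRow Unit t) hrL hryL
    have := congrFun (congrFun this ()) ()
    rw [secondMoment_residual_right hv hy' hz hdet] at this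
    exact this
  rw [← h1, ← h2, msgVar_eq hy hz hdet, ← integral_add_mul_sq htr (hryL ())]
  exact integral_nonneg fun _ => sq_nonneg _

/-- Regression on `(y, z)` in two steps. -/
theorem residual_obs_eq (hv : ∀ i, MemLp (fun ω => v ω i) 2 Q) (hy : MemLp y 2 Q)
    (hz : ∀ j, MemLp (fun ω => z ω j) 2 Q) (hdet : IsUnit (secondMoment Q z z).det)
    (hs : msgVar Q y z ≠ 0) (ω : Ω) (i : ι) :
    residual Q v (obs y z) ω i = residual Q v z ω i -
      msgCov Q v y z i / msgVar Q y z * residual Q (fun ω (_ : Unit) => y ω) z ω () := by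
  have hy' : ∀ j : Unit, MemLp (fun ω => (fun ω (_ : Unit) => y ω) ω j) 2 Q := fun _ => hy
  have hGdet : IsUnit (secondMoment Q (obs y z) (obs y z)).det := by
    rw [det_secondMoment_obs hy hz hdet]
    exact hdet.mul (isUnit_iff_ne_zero.2 hs)
  set ry := residual Q (fun ω (_ : Unit) => y ω) z with hry
  have hryL : ∀ j, MemLp (fun ω => ry ω j) 2 Q := memLp_residual hy' hz
  set a : Matrix ι Unit ℝ := of fun i _ => msgCov Q v y z i / msgVar Q y z with ha
  set Bv := secondMoment Q v z * (secondMoment Q z z)⁻¹ with hBv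
  set By := secondMoment Q (fun ω (_ : Unit) => y ω) z * (secondMoment Q z z)⁻¹ with hBy
  -- Coefficients of the candidate: regress `v` on `z`, then add `a` times the residual of `y`,
  -- which is `y - By z`.
  set R : Matrix ι (Unit ⊕ τ) ℝ := fromCols a (Bv - a * By) with hR
  have hRq : ∀ ω, v ω - R *ᵥ obs y z ω = residual Q v z ω - a *ᵥ ry ω := by
    intro ω
    have : obs y z ω = Sum.elim (fun _ => y ω) (z ω) := rfl
    rw [this, hR, fromCols_mulVec_sumElim, sub_mulVec, hry, residual, residual, mulVec_sub,
      mulVec_mulVec, ← hBv, ← hBy]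
    abel
  -- The candidate error is orthogonal to `y` and to `z`; as the moment matrix of `(y, z)` is
  -- invertible, this identifies `R` as the regression matrix.
  have hzero : secondMoment Q (fun ω => v ω - R *ᵥ obs y z ω) (obs y z) = 0 := by
    simp_rw [hRq]
    rw [secondMoment_sub_left (memLp_residual hv hz) (memLp_mulVec _ hryL) (memLp_obs hy hz),
      secondMoment_mulVec_left _ hryL (memLp_obs hy hz), sub_eq_zero]
    ext i j
    rcases j with j | j
    · calc _ = msgCov Q v y z i := rfl
        _ = a i () * msgVar Q y z := by simp [ha, hs]
        _ = _ := by simp [Matrix.mul_apply]; left; rfl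
    · have e1 := congrFun (congrFun (secondMoment_residual_obs hv hz hdet) i) j
      have e2 := congrFun (congrFun (secondMoment_residual_obs hy' hz hdet) ()) j
      calc _ = (0 : ℝ) := e1
        _ = a i () * secondMoment Q ry z () j := by rw [e2]; simp
        _ = _ := by simp [Matrix.mul_apply]; left; rfl
  have hRG : secondMoment Q v (obs y z) = R * secondMoment Q (obs y z) (obs y z) := by
    rw [secondMoment_sub_left hv (memLp_mulVec _ (memLp_obs hy hz)) (memLp_obs hy hz),
      secondMoment_mulVec_left _ (memLp_obs hy hz) (memLp_obs hy hz), sub_eq_zero] at hzero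
    exact hzero
  have hres : residual Q v (obs y z) ω = v ω - R *ᵥ obs y z ω := by
    rw [residual, hRG, Matrix.mul_assoc, mul_nonsing_inv _ hGdet, Matrix.mul_one]
  rw [hres, hRq]
  simp [mulVec, dotProduct, ha]

/-- Expand the square of `r_i - (c_i / s) r_y`, with `c` and `s` the values of `msgCov` and
`msgVar`: the message lowers the error of component `i` by `c_i² / s`. -/
theorem integral_residual_obs_sq (hv : ∀ i, MemLp (fun ω => v ω i) 2 Q) (hy : MemLp y 2 Q)
    (hz : ∀ j, MemLp (fun ω => z ω j) 2 Q) (hdet : IsUnit (secondMoment Q z z).det)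
    (hs : msgVar Q y z ≠ 0) (i : ι) :
    ∫ ω, residual Q v (obs y z) ω i ^ 2 ∂Q = secondMoment Q (residual Q v z) v i i -
      msgCov Q v y z i ^ 2 / msgVar Q y z := by
  have hy' : ∀ j : Unit, MemLp (fun ω => (fun ω (_ : Unit) => y ω) ω j) 2 Q := fun _ => hy
  have h1 : ∫ ω, residual Q v z ω i ^ 2 ∂Q = secondMoment Q (residual Q v z) v i i := by
    rw [← secondMoment_residual_right hv hv hz hdet]
    simp [secondMoment, pow_two]
  have h2 : ∫ ω, residual Q v z ω i * residual Q (fun ω (_ : Unit) => y ω) z ω () ∂Q =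
      msgCov Q v y z i := by
    rw [msgCov, ← secondMoment_residual_right hv hy' hz hdet]
    rfl
  set b := msgCov Q v y z i / msgVar Q y z with hb
  have h3 : ∀ ω, residual Q v (obs y z) ω i = residual Q v z ω i +
      (-b) * residual Q (fun ω (_ : Unit) => y ω) z ω () := fun ω => by
    rw [residual_obs_eq hv hy hz hdet hs]
    ring
  simp_rw [h3]
  rw [integral_add_mul_sq (memLp_residual hv hz i) (memLp_residual hy' hz ()), h1, h2,
    ← msgVar_eq hy hz hdet, hb]
  field_simp
  ring

end Message

/-! ### The joint law of the state of the world and the message -/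

section Joint

variable {Ω I : Type*} [MeasurableSpace Ω] [MeasurableSpace I] {P : Measure Ω}
  [IsProbabilityMeasure P] {o : Ω → I}

/-- The joint law of `ω` and the message `y ~ γ (· | o)`. -/
def joint (P : Measure Ω) (ho : Measurable o) (γ : Policy I ℝ) : Measure (Ω × ℝ) :=
  P ⊗ₘ (γ.1.comap o ho)

instance (ho : Measurable o) (γ : Policy I ℝ) : IsProbabilityMeasure (joint P ho γ) := by
  have := γ.2
  unfold joint
  infer_instance

theorem lintegral_joint (ho : Measurable o) (γ : Policy I ℝ) {f : Ω × ℝ → ℝ≥0∞}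
    (hf : Measurable f) :
    ∫⁻ q, f q ∂(joint P ho γ) = ∫⁻ ω, ∫⁻ y, f (ω, y) ∂(γ.1 (o ω)) ∂P := by
  have := γ.2
  rw [joint, Measure.lintegral_compProd hf]
  rfl

theorem integral_joint (ho : Measurable o) (γ : Policy I ℝ) {f : Ω × ℝ → ℝ}
    (hf : Integrable f (joint P ho γ)) :
    ∫ q, f q ∂(joint P ho γ) = msgExpect P o γ (fun ω y => f (ω, y)) := by
  have := γ.2
  rw [joint, Measure.integral_compProd hf]
  rfl

theorem measurePreserving_fst_joint (ho : Measurable o) (γ : Policy I ℝ) :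
    MeasurePreserving Prod.fst (joint P ho γ) P := by
  have := γ.2
  exact ⟨measurable_fst, Measure.fst_compProd P _⟩

theorem memLp_comp_fst (ho : Measurable o) (γ : Policy I ℝ) {f : Ω → ℝ} (hf : MemLp f 2 P) :
    MemLp (fun q : Ω × ℝ => f q.1) 2 (joint P ho γ) :=
  hf.comp_measurePreserving (measurePreserving_fst_joint ho γ)

theorem secondMoment_joint {ι κ : Type*} (ho : Measurable o) (γ : Policy I ℝ)
    {f : Ω → ι → ℝ} {g : Ω → κ → ℝ} (hf : ∀ i, MemLp (fun ω => f ω i) 2 P)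
    (hg : ∀ i, MemLp (fun ω => g ω i) 2 P) :
    secondMoment (joint P ho γ) (fun q => f q.1) (fun q => g q.1) = secondMoment P f g := by
  have := γ.2
  ext i j
  simp only [secondMoment, of_apply]
  have hi : Integrable (fun q : Ω × ℝ => f q.1 i * g q.1 j) (joint P ho γ) :=
    (memLp_comp_fst ho γ (hf i)).integrable_mul (memLp_comp_fst ho γ (hg j))
  rw [integral_joint ho γ hi]
  simp [msgExpect]

theorem residual_joint {ι τ : Type*} [Fintype τ] [DecidableEq τ] (ho : Measurable o)
    (γ : Policy I ℝ) {f : Ω → ι → ℝ} {z : Ω → τ → ℝ} (hf : ∀ i, MemLp (fun ω => f ω i) 2 P)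
    (hz : ∀ i, MemLp (fun ω => z ω i) 2 P) (q : Ω × ℝ) :
    residual (joint P ho γ) (fun q => f q.1) (fun q => z q.1) q = residual P f z q.1 := by
  simp only [residual]
  rw [secondMoment_joint ho γ hf hz, secondMoment_joint ho γ hz hz]

theorem memLp_snd_joint (ho : Measurable o) (γ : Policy I ℝ)
    (h : ∫⁻ ω, ∫⁻ y, ‖y‖ₑ ^ 2 ∂(γ.1 (o ω)) ∂P ≠ ∞) :
    MemLp (fun q : Ω × ℝ => q.2) 2 (joint P ho γ) := by
  refine ⟨measurable_snd.aestronglyMeasurable, ?_⟩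
  rw [eLpNorm_lt_top_iff_lintegral_rpow_enorm_lt_top (by norm_num) (by norm_num)]
  have := lintegral_joint (P := P) ho γ (f := fun q => ‖q.2‖ₑ ^ 2) (by fun_prop)
  simp only [ENNReal.toReal_ofNat, ENNReal.rpow_ofNat]
  rw [this]
  exact h.lt_top

variable {n nz : ℕ} {v : Ω → Vec n} {z : Ω → Vec nz}

theorem obsMoment_eq (ho : Measurable o) (γ : Policy I ℝ) (hz : ∀ i, MemLp (fun ω => z ω i) 2 P)
    (h : MemLp (fun q : Ω × ℝ => q.2) 2 (joint P ho γ)) :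
    obsMoment P z o γ = secondMoment (joint P ho γ)
      (obs (fun q => q.2) fun q => (z q.1).ofLp) (obs (fun q => q.2) fun q => (z q.1).ofLp) := by
  have hL := memLp_obs h (fun i => memLp_comp_fst ho γ (hz i))
  ext i j
  exact (integral_joint ho γ ((hL i).integrable_mul (hL j))).symm

theorem crossMoment_eq (ho : Measurable o) (γ : Policy I ℝ) (hv : ∀ i, MemLp (fun ω => v ω i) 2 P)
    (hz : ∀ i, MemLp (fun ω => z ω i) 2 P)
    (h : MemLp (fun q : Ω × ℝ => q.2) 2 (joint P ho γ)) :
    crossMoment P v z o γ = secondMoment (joint P ho γ) (fun q => (v q.1).ofLp)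
      (obs (fun q => q.2) fun q => (z q.1).ofLp) := by
  have hL := memLp_obs h (fun i => memLp_comp_fst ho γ (hz i))
  ext i j
  exact (integral_joint ho γ ((memLp_comp_fst ho γ (hv i)).integrable_mul (hL j))).symm

theorem isRegular_iff (ho : Measurable o) (γ : Policy I ℝ) (hz : ∀ i, MemLp (fun ω => z ω i) 2 P)
    (hdet : IsUnit (secondMoment P (fun ω => (z ω).ofLp) (fun ω => (z ω).ofLp)).det) :
    IsRegular P z o γ ↔ ∫⁻ ω, ∫⁻ y, ‖y‖ₑ ^ 2 ∂(γ.1 (o ω)) ∂P ≠ ∞ ∧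
      msgVar (joint P ho γ) (fun q => q.2) (fun q => (z q.1).ofLp) ≠ 0 := by
  refine and_congr_right fun h => ?_
  have hy := memLp_snd_joint ho γ h
  rw [obsMoment_eq ho γ hz hy, det_secondMoment_obs hy (fun i => memLp_comp_fst ho γ (hz i)),
    secondMoment_joint ho γ hz hz, IsUnit.mul_iff, isUnit_iff_ne_zero, isUnit_iff_ne_zero]
  · exact and_iff_right hdet.ne_zero
  · rwa [secondMoment_joint ho γ hz hz]

/-! ### The errors of the linear estimators -/

theorem measurable_lmmse (P : Measure Ω) (v : Ω → Vec n) (z : Ω → Vec nz) (o : Ω → I)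
    (γ : Policy I ℝ) : Measurable (lmmse P v z o γ) := by
  have h : Measurable fun q : ℝ × Vec nz => stackYZ q.1 q.2 := by
    refine measurable_pi_lambda _ fun i => ?_
    rcases i with i | i
    · exact measurable_fst
    · simp only [stackYZ, Sum.elim_inr]
      fun_prop
  have hlin : ∀ {κ : Type} [Fintype κ] (A : Matrix (Fin n) κ ℝ),
      Measurable fun u : κ → ℝ => WithLp.toLp 2 (A *ᵥ u) := fun A => by
    refine (WithLp.measurable_toLp 2 _).comp (measurable_pi_lambda _ fun i => ?_)
    simp only [mulVec, dotProduct]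
    fun_prop
  unfold lmmse
  split_ifs
  · exact (hlin _).comp h
  · exact (hlin _).comp ((WithLp.measurable_ofLp 2 _).comp measurable_snd)

/-- The policy that uses the linear minimum mean square error estimate. -/
def lmmsePolicy (P : Measure Ω) (v : Ω → Vec n) (z : Ω → Vec nz) (o : Ω → I)
    (γ : Policy I ℝ) : Policy (ℝ × Vec nz) (Vec n) :=
  ⟨Kernel.deterministic (lmmse P v z o γ) (measurable_lmmse P v z o γ), inferInstance⟩

theorem lmmsePolicy_apply (P : Measure Ω) (v : Ω → Vec n) (z : Ω → Vec nz) (o : Ω → I)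
    (γ : Policy I ℝ) (q : ℝ × Vec nz) :
    (lmmsePolicy P v z o γ).1 q = Measure.dirac (lmmse P v z o γ q) :=
  Kernel.deterministic_apply (measurable_lmmse P v z o γ) _

theorem enorm_sq_eq_ofReal_sum (a : Vec n) : ‖a‖ₑ ^ 2 = ENNReal.ofReal (∑ i, a i ^ 2) := by
  rw [← ofReal_norm, ← ENNReal.ofReal_pow (norm_nonneg _), EuclideanSpace.norm_sq_eq]
  simp

theorem lintegral_enorm_sq {Ω' : Type*} [MeasurableSpace Ω'] {Q : Measure Ω'} {e : Ω' → Vec n}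
    (he : ∀ i, MemLp (fun q => e q i) 2 Q) :
    ∫⁻ q, ‖e q‖ₑ ^ 2 ∂Q = ENNReal.ofReal (∑ i, ∫ q, e q i ^ 2 ∂Q) := by
  simp_rw [enorm_sq_eq_ofReal_sum]
  rw [← integral_finsetSum _ fun i _ => (he i).integrable_sq, ofReal_integral_eq_lintegral_ofReal]
  · exact integrable_finsetSum _ fun i _ => (he i).integrable_sq
  · exact .of_forall fun q => Finset.sum_nonneg fun i _ => sq_nonneg _

theorem estError_lmmsePolicy (ho : Measurable o) (hvm : Measurable v) (hzm : Measurable z)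
    (γ : Policy I ℝ) :
    estError P v z o γ (lmmsePolicy P v z o γ) =
      ∫⁻ q, ‖v q.1 - lmmse P v z o γ (q.2, z q.1)‖ₑ ^ 2 ∂(joint P ho γ) := by
  have hm := measurable_lmmse P v z o γ
  rw [lintegral_joint ho γ (by fun_prop), estError]
  simp only [lmmsePolicy_apply]
  congr 1 with ω
  congr 1 with y
  rw [lintegral_dirac' _ (by fun_prop)]

theorem lmmse_residual_regular (ho : Measurable o) {γ : Policy I ℝ}
    (hv : ∀ i, MemLp (fun ω => v ω i) 2 P) (hz : ∀ i, MemLp (fun ω => z ω i) 2 P)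
    (hreg : IsRegular P z o γ) (q : Ω × ℝ) :
    (v q.1 - lmmse P v z o γ (q.2, z q.1)).ofLp =
      residual (joint P ho γ) (fun q => (v q.1).ofLp)
        (obs (fun q => q.2) fun q => (z q.1).ofLp) q := by
  have hy := memLp_snd_joint ho γ hreg.1
  rw [lmmse, if_pos hreg, obsMoment_eq ho γ hz hy, crossMoment_eq ho γ hv hz hy]
  rfl

/-- Nonnegativity of `r` is recorded because `ENNReal.ofReal` truncates; it allows the sender's cost
to be computed in `ℝ`. -/
theorem estError_lmmsePolicy_regular (ho : Measurable o) (hvm : Measurable v) (hzm : Measurable z)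
    (hv : ∀ i, MemLp (fun ω => v ω i) 2 P) (hz : ∀ i, MemLp (fun ω => z ω i) 2 P)
    (hdet : IsUnit (secondMoment P (fun ω => (z ω).ofLp) (fun ω => (z ω).ofLp)).det)
    {γ : Policy I ℝ} (hreg : IsRegular P z o γ) {r : ℝ}
    (hr : r = ∑ i, (secondMoment P (residual P (fun ω => (v ω).ofLp) fun ω => (z ω).ofLp)
        (fun ω => (v ω).ofLp) i i -
      msgCov (joint P ho γ) (fun q => (v q.1).ofLp) (fun q => q.2) (fun q => (z q.1).ofLp) i ^ 2 /
        msgVar (joint P ho γ) (fun q => q.2) (fun q => (z q.1).ofLp))) :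
    estError P v z o γ (lmmsePolicy P v z o γ) = ENNReal.ofReal r ∧ 0 ≤ r := by
  have hy := memLp_snd_joint ho γ hreg.1
  have hs := ((isRegular_iff ho γ hz hdet).1 hreg).2
  have hv' := fun i => memLp_comp_fst ho γ (hv i)
  have hz' := fun i => memLp_comp_fst ho γ (hz i)
  have hdet' : IsUnit (secondMoment (joint P ho γ) (fun q => (z q.1).ofLp)
      (fun q => (z q.1).ofLp)).det := by rwa [secondMoment_joint ho γ hz hz]
  have hres : ∀ q i, (v q.1 - lmmse P v z o γ (q.2, z q.1)) i =
      residual (joint P ho γ) (fun q => (v q.1).ofLp)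
        (obs (fun q => q.2) fun q => (z q.1).ofLp) q i := fun q i =>
    congrFun (lmmse_residual_regular ho hv hz hreg q) i
  have hsum : ∑ i, ∫ q, (v q.1 - lmmse P v z o γ (q.2, z q.1)) i ^ 2 ∂(joint P ho γ) = r := by
    rw [hr]
    refine Finset.sum_congr rfl fun i _ => ?_
    simp_rw [hres]
    rw [integral_residual_obs_sq hv' hy hz' hdet' hs]
    rw [← secondMoment_joint ho γ (memLp_residual hv hz) hv]
    simp_rw [← residual_joint ho γ hv hz]
  rw [estError_lmmsePolicy ho hvm hzm, lintegral_enorm_sq, hsum]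
  · exact ⟨rfl, hsum ▸ Finset.sum_nonneg fun i _ => integral_nonneg fun _ => sq_nonneg _⟩
  · intro i
    simp_rw [hres]
    exact memLp_residual hv' (memLp_obs hy hz') i

theorem estError_lmmsePolicy_not_regular (ho : Measurable o) (hvm : Measurable v)
    (hzm : Measurable z)
    (hv : ∀ i, MemLp (fun ω => v ω i) 2 P) (hz : ∀ i, MemLp (fun ω => z ω i) 2 P)
    (hdet : IsUnit (secondMoment P (fun ω => (z ω).ofLp) (fun ω => (z ω).ofLp)).det)
    {γ : Policy I ℝ} (hreg : ¬ IsRegular P z o γ) {r : ℝ}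
    (hr : r = ∑ i, secondMoment P (residual P (fun ω => (v ω).ofLp) fun ω => (z ω).ofLp)
        (fun ω => (v ω).ofLp) i i) :
    estError P v z o γ (lmmsePolicy P v z o γ) = ENNReal.ofReal r ∧ 0 ≤ r := by
  have hres : ∀ ω y, v ω - lmmse P v z o γ (y, z ω) =
      WithLp.toLp 2 (residual P (fun ω => (v ω).ofLp) (fun ω => (z ω).ofLp) ω) := fun ω y => by
    rw [lmmse, if_neg hreg]
    rfl
  have hsum : ∑ i, ∫ ω, (WithLp.toLp 2
      (residual P (fun ω => (v ω).ofLp) (fun ω => (z ω).ofLp) ω) : Vec n) i ^ 2 ∂P = r := by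
    rw [hr]
    refine Finset.sum_congr rfl fun i _ => ?_
    rw [← secondMoment_residual_right hv hv hz hdet]
    simp [secondMoment, pow_two]
  have hγ := γ.2
  have : estError P v z o γ (lmmsePolicy P v z o γ) = ∫⁻ ω, ‖(WithLp.toLp 2
      (residual P (fun ω => (v ω).ofLp) (fun ω => (z ω).ofLp) ω) : Vec n)‖ₑ ^ 2 ∂P := by
    rw [estError_lmmsePolicy ho hvm hzm, lintegral_joint ho γ
      (by have := measurable_lmmse P v z o γ; fun_prop)]
    simp [hres]
  rw [this, lintegral_enorm_sq (fun i => memLp_residual hv hz i), hsum]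
  exact ⟨rfl, hsum ▸ Finset.sum_nonneg fun i _ => integral_nonneg fun _ => sq_nonneg _⟩

end Joint

/-! ### Optimality of linear estimators for Gaussian messages -/

section Optimality

variable {Ω : Type*} [MeasurableSpace Ω] {P : Measure Ω} [IsProbabilityMeasure P] {n : ℕ}

/-- For centred `u` the cross term vanishes, and the shift adds `‖c‖²`. -/
theorem lintegral_enorm_sq_le_add_const {u : Ω → Vec n} (hu : ∀ i, MemLp (fun ω => u ω i) 2 P)
    (hmean : ∀ i, ∫ ω, u ω i ∂P = 0) (c : Vec n) :
    ∫⁻ ω, ‖u ω‖ₑ ^ 2 ∂P ≤ ∫⁻ ω, ‖u ω + c‖ₑ ^ 2 ∂P := by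
  rw [lintegral_enorm_sq hu, lintegral_enorm_sq (e := fun ω => u ω + c)
    fun i => (hu i).add (memLp_const (c i))]
  refine ENNReal.ofReal_le_ofReal (Finset.sum_le_sum fun i _ => ?_)
  have h := integral_add_mul_sq (hu i) (memLp_const (1 : ℝ)) (c i)
  simp only [mul_one, hmean i, mul_zero, add_zero] at h
  simp only [PiLp.add_apply]
  rw [h]
  simpa using sq_nonneg (c i)

/-- Here `u + m(q)` is the vector to be estimated from `q`. Given `q` and the drawn estimate `vh`,
the quantity `m(q) - vh` is a constant, while the independent `u` keeps its centred law; the shift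
inequality then applies under the integral. -/
theorem lintegral_enorm_sq_le_of_indepFun {B : Type*} [MeasurableSpace B] {u : Ω → Vec n}
    {q : Ω → B} (hum : Measurable u) (hqm : Measurable q) (hind : IndepFun u q P)
    (hu : ∀ i, MemLp (fun ω => u ω i) 2 P) (hmean : ∀ i, ∫ ω, u ω i ∂P = 0)
    {m : B → Vec n} (hm : Measurable m) (e : Kernel B (Vec n)) [IsMarkovKernel e] :
    ∫⁻ ω, ‖u ω‖ₑ ^ 2 ∂P ≤ ∫⁻ ω, ∫⁻ vh, ‖u ω + m (q ω) - vh‖ₑ ^ 2 ∂(e (q ω)) ∂P := by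
  have : IsProbabilityMeasure (P.map u) := Measure.isProbabilityMeasure_map hum.aemeasurable
  have : IsProbabilityMeasure (P.map q) := Measure.isProbabilityMeasure_map hqm.aemeasurable
  have hF : Measurable fun p : B × Vec n => ∫⁻ vh, ‖p.2 + m p.1 - vh‖ₑ ^ 2 ∂(e p.1) := by
    have := Measurable.lintegral_kernel_prod_right (κ := e.comap Prod.fst measurable_fst)
      (f := fun (p : B × Vec n) vh => ‖p.2 + m p.1 - vh‖ₑ ^ 2) (by fun_prop)
    exact this
  have hmap : P.map (fun ω => (q ω, u ω)) = (P.map q).prod (P.map u) :=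
    (indepFun_iff_map_prod_eq_prod_map_map hqm.aemeasurable hum.aemeasurable).1 hind.symm
  calc ∫⁻ ω, ‖u ω‖ₑ ^ 2 ∂P
      = ∫⁻ b, ∫⁻ _, ∫⁻ ω, ‖u ω‖ₑ ^ 2 ∂P ∂(e b) ∂(P.map q) := by simp
    _ ≤ ∫⁻ b, ∫⁻ vh, ∫⁻ ω, ‖u ω + (m b - vh)‖ₑ ^ 2 ∂P ∂(e b) ∂(P.map q) :=
        lintegral_mono fun b => lintegral_mono fun vh =>
          lintegral_enorm_sq_le_add_const hu hmean _
    _ = ∫⁻ b, ∫⁻ vh, ∫⁻ a, ‖a + m b - vh‖ₑ ^ 2 ∂(P.map u) ∂(e b) ∂(P.map q) := by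
        congr 1 with b
        congr 1 with vh
        rw [lintegral_map (by fun_prop) hum]
        simp only [add_sub_assoc]
    _ = ∫⁻ b, ∫⁻ a, ∫⁻ vh, ‖a + m b - vh‖ₑ ^ 2 ∂(e b) ∂(P.map u) ∂(P.map q) := by
        congr 1 with b
        rw [lintegral_lintegral_swap]
        fun_prop
    _ = ∫⁻ p, ∫⁻ vh, ‖p.2 + m p.1 - vh‖ₑ ^ 2 ∂(e p.1) ∂((P.map q).prod (P.map u)) := by
        rw [lintegral_prod _ hF.aemeasurable]
    _ = _ := by
        rw [← hmap, lintegral_map hF (by fun_prop)]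

variable {τ : Type*} [Fintype τ] [DecidableEq τ]

theorem integral_residual_eq_zero {ι : Type*} {f : Ω → ι → ℝ} {g : Ω → τ → ℝ}
    (hf : ∀ i, MemLp (fun ω => f ω i) 2 P) (hg : ∀ i, MemLp (fun ω => g ω i) 2 P)
    (hf0 : ∀ i, ∫ ω, f ω i ∂P = 0) (hg0 : ∀ i, ∫ ω, g ω i ∂P = 0) (i : ι) :
    ∫ ω, residual P f g ω i ∂P = 0 := by
  simp only [residual, Pi.sub_apply]
  rw [integral_sub ((hf i).integrable (by norm_num))
    ((memLp_mulVec _ hg i).integrable (by norm_num)), hf0, zero_sub, neg_eq_zero]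
  simp only [mulVec, dotProduct]
  rw [integral_finsetSum _ fun j _ => ((hg j).integrable (by norm_num)).const_mul _]
  simp [integral_const_mul, hg0]

/-- For jointly Gaussian vectors the residual is independent of the regressors. -/
theorem indepFun_residual {ι : Type*} [Fintype ι] {f : Ω → ι → ℝ} {g : Ω → τ → ℝ}
    (hG : HasGaussianLaw (fun ω => (f ω, g ω)) P)
    (hf : ∀ i, MemLp (fun ω => f ω i) 2 P) (hg : ∀ i, MemLp (fun ω => g ω i) 2 P)
    (hg0 : ∀ i, ∫ ω, g ω i ∂P = 0)
    (hdet : IsUnit (secondMoment P g g).det) :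
    IndepFun (residual P f g) g P := by
  -- `(residual, g)` is the image of `(f, g)` under the linear map `(a, b) ↦ (a - A b, b)`, hence
  -- jointly Gaussian; zero covariance then gives independence.
  have hG' : HasGaussianLaw (fun ω => (residual P f g ω, g ω)) P := by
    let A := secondMoment P f g * (secondMoment P g g)⁻¹
    let T : ((ι → ℝ) × (τ → ℝ)) →ₗ[ℝ] ((ι → ℝ) × (τ → ℝ)) :=
      (LinearMap.fst ℝ _ _ - A.mulVecLin ∘ₗ LinearMap.snd ℝ _ _).prod (LinearMap.snd ℝ _ _)
    exact hG.map_fun (LinearMap.toContinuousLinearMap T)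
  refine HasGaussianLaw.indepFun_of_covariance_eval (X := fun i ω => residual P f g ω i)
    (Y := fun j ω => g ω j) hG' fun i j => ?_
  rw [covariance_eq_sub (memLp_residual hf hg i) (hg j), hg0, mul_zero, sub_zero]
  exact congrFun (congrFun (secondMoment_residual_obs hf hg hdet) i) j

end Optimality

/-! ### Deterministic messages and best responses to them. -/

section Deterministic

variable {Ω I : Type*} [MeasurableSpace Ω] [MeasurableSpace I] {P : Measure Ω}
  {o : Ω → I} {n nz : ℕ} {v : Ω → Vec n} {z : Ω → Vec nz}
  {γ : Policy I ℝ} {Y : Ω → ℝ}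

theorem joint_of_dirac [IsProbabilityMeasure P] (ho : Measurable o) (hY : Measurable Y)
    (hγ : ∀ ω, γ.1 (o ω) = Measure.dirac (Y ω)) :
    joint P ho γ = P.map fun ω => (ω, Y ω) := by
  have : γ.1.comap o ho = Kernel.deterministic Y hY := by
    ext1 ω
    rw [Kernel.comap_apply, hγ, Kernel.deterministic_apply]
  rw [joint, this, Measure.compProd_deterministic]

theorem obsMoment_of_dirac (hγ : ∀ ω, γ.1 (o ω) = Measure.dirac (Y ω)) :
    obsMoment P z o γ = secondMoment P (obs Y fun ω => (z ω).ofLp)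
      (obs Y fun ω => (z ω).ofLp) := by
  ext i j
  simp [obsMoment, secondMoment, msgExpect, hγ, obs, stackYZ]

theorem crossMoment_of_dirac (hγ : ∀ ω, γ.1 (o ω) = Measure.dirac (Y ω)) :
    crossMoment P v z o γ = secondMoment P (fun ω => (v ω).ofLp)
      (obs Y fun ω => (z ω).ofLp) := by
  ext i j
  simp [crossMoment, secondMoment, msgExpect, hγ, obs, stackYZ]

theorem estError_of_dirac (hγ : ∀ ω, γ.1 (o ω) = Measure.dirac (Y ω))
    (e : Policy (ℝ × Vec nz) (Vec n)) :
    estError P v z o γ e = ∫⁻ ω, ∫⁻ vh, ‖v ω - vh‖ₑ ^ 2 ∂(e.1 (Y ω, z ω)) ∂P := by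
  simp [estError, hγ]

/-- The error `v - lmmse` is the regression residual on `(Y, z)`: centred and, by joint Gaussianity,
independent of `(Y, z)`. -/
theorem estError_lmmsePolicy_le [IsProbabilityMeasure P] (hvm : Measurable v) (hzm : Measurable z) (hYm : Measurable Y)
    (hγ : ∀ ω, γ.1 (o ω) = Measure.dirac (Y ω)) (hreg : IsRegular P z o γ)
    (hG : HasGaussianLaw (fun ω => ((v ω).ofLp, obs Y (fun ω => (z ω).ofLp) ω)) P)
    (hv : ∀ i, MemLp (fun ω => v ω i) 2 P) (hz : ∀ i, MemLp (fun ω => z ω i) 2 P)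
    (hY : MemLp Y 2 P) (hv0 : ∀ i, ∫ ω, v ω i ∂P = 0) (hz0 : ∀ i, ∫ ω, z ω i ∂P = 0)
    (hY0 : ∫ ω, Y ω ∂P = 0) (e : Policy (ℝ × Vec nz) (Vec n)) :
    estError P v z o γ (lmmsePolicy P v z o γ) ≤ estError P v z o γ e := by
  have := e.2
  have hm := measurable_lmmse P v z o γ
  have hdet := hreg.2
  rw [obsMoment_of_dirac hγ] at hdet
  have hobs := memLp_obs hY hz
  have hobs0 : ∀ j, ∫ ω, obs Y (fun ω => (z ω).ofLp) ω j ∂P = 0 := by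
    rintro (j | j)
    exacts [hY0, hz0 j]
  set u : Ω → Vec n := fun ω => v ω - lmmse P v z o γ (Y ω, z ω) with hu
  have hres : ∀ ω, (u ω).ofLp =
      residual P (fun ω => (v ω).ofLp) (obs Y fun ω => (z ω).ofLp) ω := fun ω => by
    simp only [hu]
    rw [lmmse, if_pos hreg, obsMoment_of_dirac hγ, crossMoment_of_dirac hγ]
    rfl
  have hum : Measurable u := by fun_prop
  have hind : IndepFun u (fun ω => (Y ω, z ω)) P := by
    have h := indepFun_residual hG hv hobs hobs0 hdet
    have h1 : Measurable fun a : Fin n → ℝ => (WithLp.toLp 2 a : Vec n) := by fun_prop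
    have h2 : Measurable fun b : Unit ⊕ Fin nz → ℝ =>
        (b (Sum.inl ()), (WithLp.toLp 2 fun j => b (Sum.inr j) : Vec nz)) := by fun_prop
    have h3 := h.comp h1 h2
    have h4 : (fun a : Fin n → ℝ => (WithLp.toLp 2 a : Vec n)) ∘
        residual P (fun ω => (v ω).ofLp) (obs Y fun ω => (z ω).ofLp) = u := by
      ext1 ω
      rw [Function.comp_apply, ← hres]
    rw [h4] at h3
    exact h3
  have hu2 : ∀ i, MemLp (fun ω => u ω i) 2 P := fun i => by
    simp_rw [hres]
    exact memLp_residual hv hobs i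
  have hu0 : ∀ i, ∫ ω, u ω i ∂P = 0 := fun i => by
    simp_rw [hres]
    exact integral_residual_eq_zero hv hobs hv0 hobs0 i
  have h := lintegral_enorm_sq_le_of_indepFun hum (by fun_prop) hind hu2 hu0 hm e.1
  rw [estError_of_dirac hγ, estError_of_dirac hγ]
  simp only [hu, sub_add_cancel] at h
  refine le_trans (le_of_eq ?_) h
  congr 1 with ω
  rw [lmmsePolicy_apply, lintegral_dirac' _ (by fun_prop)]

end Deterministic

/-! ### Linear messages -/

section LinearMessage

variable {Ω Ω' : Type*} [MeasurableSpace Ω] [MeasurableSpace Ω'] {P : Measure Ω} {ι κ τ : Type*}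

theorem secondMoment_map {h : Ω → Ω'} (hh : Measurable h) {f : Ω' → ι → ℝ} {g : Ω' → κ → ℝ}
    (hf : ∀ i, Measurable fun q => f q i) (hg : ∀ i, Measurable fun q => g q i) :
    secondMoment (P.map h) f g = secondMoment P (fun ω => f (h ω)) (fun ω => g (h ω)) := by
  ext i j
  simp only [secondMoment, of_apply]
  exact integral_map hh.aemeasurable ((hf i).mul (hg j)).aestronglyMeasurable

variable [Fintype τ] [DecidableEq τ]

theorem residual_map {h : Ω → Ω'} (hh : Measurable h) {f : Ω' → ι → ℝ} {z : Ω' → τ → ℝ}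
    (hf : ∀ i, Measurable fun q => f q i) (hz : ∀ i, Measurable fun q => z q i) (ω : Ω) :
    residual (P.map h) f z (h ω) = residual P (fun ω => f (h ω)) (fun ω => z (h ω)) ω := by
  simp only [residual]
  rw [secondMoment_map hh hf hz, secondMoment_map hh hz hz]

theorem measurable_residual {f : Ω → ι → ℝ} {z : Ω → τ → ℝ}
    (hf : ∀ i, Measurable fun q => f q i) (hz : ∀ i, Measurable fun q => z q i) (i : ι) :
    Measurable fun ω => residual P f z ω i := by
  simp only [residual, Pi.sub_apply, mulVec, dotProduct]
  fun_prop

theorem msgCov_map {h : Ω → Ω'} (hh : Measurable h) {f : Ω' → ι → ℝ} {y : Ω' → ℝ} {z : Ω' → τ → ℝ}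
    (hf : ∀ i, Measurable fun q => f q i) (hy : Measurable y)
    (hz : ∀ i, Measurable fun q => z q i) :
    msgCov (P.map h) f y z = msgCov P (fun ω => f (h ω)) (fun ω => y (h ω)) (fun ω => z (h ω)) := by
  ext i
  simp only [msgCov]
  rw [secondMoment_map hh (measurable_residual hf hz) (fun _ => hy)]
  simp_rw [residual_map hh hf hz]

theorem msgVar_map {h : Ω → Ω'} (hh : Measurable h) {y : Ω' → ℝ} {z : Ω' → τ → ℝ}
    (hy : Measurable y) (hz : ∀ i, Measurable fun q => z q i) :
    msgVar (P.map h) y z = msgVar P (fun ω => y (h ω)) (fun ω => z (h ω)) := by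
  have hy' : ∀ i : Unit, Measurable fun q => (fun q (_ : Unit) => y q) q i := fun _ => hy
  simp only [msgVar]
  rw [secondMoment_map hh (measurable_residual hy' hz) hy']
  simp_rw [residual_map hh hy' hz]

variable [Fintype ι] {U : Ω → ι → ℝ} {z : Ω → τ → ℝ}

theorem msgCov_dotProduct (hU : ∀ i, MemLp (fun ω => U ω i) 2 P)
    (hz : ∀ i, MemLp (fun ω => z ω i) 2 P) (K : ι → ℝ) :
    msgCov P U (fun ω => K ⬝ᵥ U ω) z = secondMoment P (residual P U z) U *ᵥ K := by
  have h := secondMoment_mulVec_right (replicateRow Unit K) hU (memLp_residual hU hz)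
  ext i
  exact congrFun (congrFun h i) ()

theorem msgVar_dotProduct (hU : ∀ i, MemLp (fun ω => U ω i) 2 P)
    (hz : ∀ i, MemLp (fun ω => z ω i) 2 P) (K : ι → ℝ) :
    msgVar P (fun ω => K ⬝ᵥ U ω) z = K ⬝ᵥ secondMoment P (residual P U z) U *ᵥ K := by
  set A := replicateRow Unit K with hA
  have hres : residual P (fun ω (_ : Unit) => K ⬝ᵥ U ω) z = fun ω => A *ᵥ residual P U z ω := by
    ext1 ω
    have h : secondMoment P (fun ω (_ : Unit) => K ⬝ᵥ U ω) z = A * secondMoment P U z :=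
      secondMoment_mulVec_left A hU hz
    rw [residual, residual, h, mulVec_sub, mulVec_mulVec, Matrix.mul_assoc]
    rfl
  have h1 := secondMoment_mulVec_left A (memLp_residual hU hz) (memLp_mulVec A hU)
  rw [secondMoment_mulVec_right A hU (memLp_residual hU hz)] at h1
  rw [msgVar, hres]
  exact congrFun (congrFun h1 ()) ()

end LinearMessage

/-! ### The sender -/

section Sender

variable {Ω I : Type*} [MeasurableSpace Ω] [MeasurableSpace I] {P : Measure Ω}
  {o : Ω → I} {nx nw nz : ℕ}
  {x : Ω → Vec nx} {w : Ω → Vec nw} {z : Ω → Vec nz} {δ : ℝ} {γ : Policy I ℝ}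

/-- The cost of the sender when nothing is transmitted. -/
def silentCost (P : Measure Ω) (x : Ω → Vec nx) (w : Ω → Vec nw) (z : Ω → Vec nz) (δ : ℝ) : ℝ :=
  ∑ i, Xi P x w z (Sum.inl i) (Sum.inl i) - δ * ∑ j, Xi P x w z (Sum.inr j) (Sum.inr j)

theorem memLp_stackXW (hx2 : ∀ i, MemLp (fun ω => x ω i) 2 P)
    (hw2 : ∀ i, MemLp (fun ω => w ω i) 2 P) (i : Fin nx ⊕ Fin nw) :
    MemLp (fun ω => stackXW x w ω i) 2 P := by
  rcases i with i | i
  exacts [hx2 i, hw2 i]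

theorem Xi_eq (hx2 : ∀ i, MemLp (fun ω => x ω i) 2 P)
    (hw2 : ∀ i, MemLp (fun ω => w ω i) 2 P) (hz2 : ∀ i, MemLp (fun ω => z ω i) 2 P) :
    Xi P x w z = secondMoment P (residual P (stackXW x w) fun ω => (z ω).ofLp) (stackXW x w) :=
  (secondMoment_residual_left (memLp_stackXW hx2 hw2) (memLp_stackXW hx2 hw2) hz2).symm

theorem senderCost_of_ofReal {a b : ℝ} {e : Policy (ℝ × Vec nz) (Vec nx)}
    {f : Policy (ℝ × Vec nz) (Vec nw)}
    (ha : estError P x z o γ e = ENNReal.ofReal a ∧ 0 ≤ a)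
    (hb : estError P w z o γ f = ENNReal.ofReal b ∧ 0 ≤ b) :
    senderCost P x w z o δ γ e f = ((a - δ * b : ℝ) : EReal) := by
  rw [senderCost, ha.1, hb.1, EReal.coe_ennreal_ofReal, EReal.coe_ennreal_ofReal,
    max_eq_left ha.2, max_eq_left hb.2]
  push_cast
  rfl

variable [IsProbabilityMeasure P]

theorem senderCost_regular (ho : Measurable o) (hx : Measurable x) (hw : Measurable w)
    (hz : Measurable z)
    (hx2 : ∀ i, MemLp (fun ω => x ω i) 2 P) (hw2 : ∀ i, MemLp (fun ω => w ω i) 2 P)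
    (hz2 : ∀ i, MemLp (fun ω => z ω i) 2 P)
    (hdet : IsUnit (secondMoment P (fun ω => (z ω).ofLp) (fun ω => (z ω).ofLp)).det)
    (hreg : IsRegular P z o γ) :
    senderCost P x w z o δ γ (lmmsePolicy P x z o γ) (lmmsePolicy P w z o γ) =
      ((silentCost P x w z δ + privacyForm δ (msgCov (joint P ho γ) (fun q => stackXW x w q.1)
        (fun q => q.2) (fun q => (z q.1).ofLp)) /
        msgVar (joint P ho γ) (fun q => q.2) (fun q => (z q.1).ofLp) : ℝ) : EReal) := by
  rw [senderCost_of_ofReal (estError_lmmsePolicy_regular ho hx hz hx2 hz2 hdet hreg rfl)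
    (estError_lmmsePolicy_regular ho hw hz hw2 hz2 hdet hreg rfl)]
  congr 1
  rw [silentCost, Xi_eq hx2 hw2 hz2, privacyForm, Finset.sum_sub_distrib, Finset.sum_sub_distrib,
    ← Finset.sum_div, ← Finset.sum_div]
  set s := msgVar (joint P ho γ) (fun q => q.2) (fun q => (z q.1).ofLp)
  have e1 : ∀ i, secondMoment P (residual P (fun ω => (x ω).ofLp) fun ω => (z ω).ofLp)
      (fun ω => (x ω).ofLp) i i = secondMoment P (residual P (stackXW x w) fun ω => (z ω).ofLp)
      (stackXW x w) (Sum.inl i) (Sum.inl i) := fun _ => rfl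
  have e2 : ∀ i, secondMoment P (residual P (fun ω => (w ω).ofLp) fun ω => (z ω).ofLp)
      (fun ω => (w ω).ofLp) i i = secondMoment P (residual P (stackXW x w) fun ω => (z ω).ofLp)
      (stackXW x w) (Sum.inr i) (Sum.inr i) := fun _ => rfl
  have e3 : ∀ i, msgCov (joint P ho γ) (fun q => (x q.1).ofLp) (fun q => q.2)
      (fun q => (z q.1).ofLp) i = msgCov (joint P ho γ) (fun q => stackXW x w q.1) (fun q => q.2)
      (fun q => (z q.1).ofLp) (Sum.inl i) := fun _ => rfl
  have e4 : ∀ i, msgCov (joint P ho γ) (fun q => (w q.1).ofLp) (fun q => q.2)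
      (fun q => (z q.1).ofLp) i = msgCov (joint P ho γ) (fun q => stackXW x w q.1) (fun q => q.2)
      (fun q => (z q.1).ofLp) (Sum.inr i) := fun _ => rfl
  simp only [e1, e2, e3, e4]
  ring

theorem senderCost_not_regular (ho : Measurable o) (hx : Measurable x) (hw : Measurable w)
    (hz : Measurable z)
    (hx2 : ∀ i, MemLp (fun ω => x ω i) 2 P) (hw2 : ∀ i, MemLp (fun ω => w ω i) 2 P)
    (hz2 : ∀ i, MemLp (fun ω => z ω i) 2 P)
    (hdet : IsUnit (secondMoment P (fun ω => (z ω).ofLp) (fun ω => (z ω).ofLp)).det)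
    (hreg : ¬ IsRegular P z o γ) :
    senderCost P x w z o δ γ (lmmsePolicy P x z o γ) (lmmsePolicy P w z o γ) =
      ((silentCost P x w z δ : ℝ) : EReal) := by
  rw [senderCost_of_ofReal (estError_lmmsePolicy_not_regular ho hx hz hx2 hz2 hdet hreg rfl)
    (estError_lmmsePolicy_not_regular ho hw hz hw2 hz2 hdet hreg rfl), silentCost,
    Xi_eq hx2 hw2 hz2]
  rfl

/-- A regular message is bounded by the eigenvalue estimate. Otherwise the estimators ignore `y`,
the cost is that of silence, and `l < 0` suffices. -/
theorem le_senderCost (hnx : 0 < nx) (ho : Measurable o) (hx : Measurable x) (hw : Measurable w)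
    (hz : Measurable z)
    (hx2 : ∀ i, MemLp (fun ω => x ω i) 2 P) (hw2 : ∀ i, MemLp (fun ω => w ω i) 2 P)
    (hz2 : ∀ i, MemLp (fun ω => z ω i) 2 P)
    (hdet : IsUnit (secondMoment P (fun ω => (z ω).ofLp) (fun ω => (z ω).ofLp)).det)
    (hXi : (Xi P x w z).PosDef) {l : ℝ}
    (hl : l ∈ lowerBounds {m : ℝ | Module.End.HasEigenvalue
      (Matrix.toLin' (privacyMatrix (Xi P x w z) δ)) m}) (γ : Policy I ℝ) :
    ((silentCost P x w z δ + l : ℝ) : EReal) ≤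
      senderCost P x w z o δ γ (lmmsePolicy P x z o γ) (lmmsePolicy P w z o γ) := by
  by_cases hreg : IsRegular P z o γ
  · rw [senderCost_regular ho hx hw hz hx2 hw2 hz2 hdet hreg, EReal.coe_le_coe_iff,
      add_le_add_iff_left]
    have hy := memLp_snd_joint ho γ hreg.1
    have hU := fun i => memLp_comp_fst ho γ (memLp_stackXW hx2 hw2 i)
    have hz' := fun i => memLp_comp_fst ho γ (hz2 i)
    have hdet' : IsUnit (secondMoment (joint P ho γ) (fun q => (z q.1).ofLp)
        (fun q => (z q.1).ofLp)).det := by rwa [secondMoment_joint ho γ hz2 hz2]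
    refine minEigenvalue_le_privacyForm_div hnx hXi hl
      (lt_of_le_of_ne (msgVar_nonneg hy hz' hdet') ((isRegular_iff ho γ hz2 hdet).1 hreg).2.symm)
      fun t α => ?_
    have h := quadratic_residual_nonneg hU hy hz' hdet' t α
    have hXi' : secondMoment (joint P ho γ) (residual (joint P ho γ) (fun q => stackXW x w q.1)
        (fun q => (z q.1).ofLp)) (fun q => stackXW x w q.1) = Xi P x w z := by
      rw [Xi_eq hx2 hw2 hz2, ← secondMoment_joint ho γ
        (memLp_residual (memLp_stackXW hx2 hw2) hz2) (memLp_stackXW hx2 hw2)]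
      simp_rw [← residual_joint ho γ (memLp_stackXW hx2 hw2) hz2]
    rwa [hXi'] at h
  · rw [senderCost_not_regular ho hx hw hz hx2 hw2 hz2 hdet hreg, EReal.coe_le_coe_iff]
    linarith [minEigenvalue_privacyMatrix_neg hnx hXi hl]

end Sender

/-! ### The equilibrium -/

section Equilibrium

variable {Ω I : Type*} [MeasurableSpace Ω] [MeasurableSpace I] {P : Measure Ω}
  {o : Ω → I} {nx nw nz : ℕ}
  {x : Ω → Vec nx} {w : Ω → Vec nw} {z : Ω → Vec nz} {δ : ℝ} {γ : Policy I ℝ}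

/-- The map `T` is kept general so that its two instances, the projections to `x` and to `w`, serve
both estimating agents. -/
theorem hasGaussianLaw_obs_dotProduct {n : ℕ}
    (hGauss : HasGaussianLaw (fun ω => (x ω, w ω, z ω)) P)
    (T : (Vec nx × Vec nw × Vec nz) →ₗ[ℝ] Vec n) (K : Fin nx ⊕ Fin nw → ℝ) :
    HasGaussianLaw (fun ω => ((T (x ω, w ω, z ω)).ofLp,
      obs (fun ω => K ⬝ᵥ stackXW x w ω) (fun ω => (z ω).ofLp) ω)) P := by
  let O : (Vec nx × Vec nw × Vec nz) →ₗ[ℝ] (Fin n → ℝ) × (Unit ⊕ Fin nz → ℝ) :=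
    { toFun := fun p => ((T p).ofLp,
        Sum.elim (fun _ => K ⬝ᵥ Sum.elim p.1.ofLp p.2.1.ofLp) p.2.2.ofLp)
      map_add' := fun p q => by
        refine Prod.ext ?_ (funext fun i => ?_)
        · simp
        · rcases i with i | i
          · simp [dotProduct, mul_add, Finset.sum_add_distrib]
            ring
          · simp
      map_smul' := fun c p => by
        refine Prod.ext ?_ (funext fun i => ?_)
        · simp
        · rcases i with i | i
          · simp [dotProduct, Finset.mul_sum, mul_add, mul_left_comm]
          · simp }
  exact hGauss.map_fun (LinearMap.toContinuousLinearMap O)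

theorem measurable_stackXW (hx : Measurable x) (hw : Measurable w) (i : Fin nx ⊕ Fin nw) :
    Measurable fun ω => stackXW x w ω i := by
  rcases i with i | i <;> simp only [stackXW, Sum.elim_inl, Sum.elim_inr] <;> fun_prop

theorem measurable_dotProduct_stackXW (hx : Measurable x) (hw : Measurable w)
    (K : Fin nx ⊕ Fin nw → ℝ) : Measurable fun ω => K ⬝ᵥ stackXW x w ω := by
  have := measurable_stackXW hx hw
  simp only [dotProduct]
  fun_prop

theorem memLp_dotProduct_stackXW (hx2 : ∀ i, MemLp (fun ω => x ω i) 2 P)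
    (hw2 : ∀ i, MemLp (fun ω => w ω i) 2 P) (K : Fin nx ⊕ Fin nw → ℝ) :
    MemLp (fun ω => K ⬝ᵥ stackXW x w ω) 2 P := by
  simp only [dotProduct]
  exact memLp_finsetSum _ fun j _ => (memLp_stackXW hx2 hw2 j).const_mul _

variable [IsProbabilityMeasure P]

theorem msgVar_joint_of_linear (ho : Measurable o) (hx : Measurable x) (hw : Measurable w)
    (hz : Measurable z)
    (hx2 : ∀ i, MemLp (fun ω => x ω i) 2 P) (hw2 : ∀ i, MemLp (fun ω => w ω i) 2 P)
    (hz2 : ∀ i, MemLp (fun ω => z ω i) 2 P) {K : Fin nx ⊕ Fin nw → ℝ}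
    (hγ : ∀ ω, γ.1 (o ω) = Measure.dirac (K ⬝ᵥ stackXW x w ω)) :
    msgVar (joint P ho γ) (fun q => q.2) (fun q => (z q.1).ofLp) = K ⬝ᵥ Xi P x w z *ᵥ K := by
  have hY := measurable_dotProduct_stackXW hx hw K
  rw [joint_of_dirac ho hY hγ, msgVar_map (by fun_prop) measurable_snd (fun i => by fun_prop),
    msgVar_dotProduct (memLp_stackXW hx2 hw2) hz2, Xi_eq hx2 hw2 hz2]

theorem msgCov_joint_of_linear (ho : Measurable o) (hx : Measurable x) (hw : Measurable w)
    (hz : Measurable z)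
    (hx2 : ∀ i, MemLp (fun ω => x ω i) 2 P) (hw2 : ∀ i, MemLp (fun ω => w ω i) 2 P)
    (hz2 : ∀ i, MemLp (fun ω => z ω i) 2 P) {K : Fin nx ⊕ Fin nw → ℝ}
    (hγ : ∀ ω, γ.1 (o ω) = Measure.dirac (K ⬝ᵥ stackXW x w ω)) :
    msgCov (joint P ho γ) (fun q => stackXW x w q.1) (fun q => q.2) (fun q => (z q.1).ofLp) =
      Xi P x w z *ᵥ K := by
  have hY := measurable_dotProduct_stackXW hx hw K
  have hU : ∀ i, Measurable fun q : Ω × ℝ => stackXW x w q.1 i := fun i =>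
    (measurable_stackXW hx hw i).comp measurable_fst
  rw [joint_of_dirac ho hY hγ, msgCov_map (by fun_prop) hU measurable_snd
    (fun i => by fun_prop), msgCov_dotProduct (memLp_stackXW hx2 hw2) hz2, Xi_eq hx2 hw2 hz2]

theorem isRegular_of_linear (ho : Measurable o) (hx : Measurable x) (hw : Measurable w)
    (hz : Measurable z)
    (hx2 : ∀ i, MemLp (fun ω => x ω i) 2 P) (hw2 : ∀ i, MemLp (fun ω => w ω i) 2 P)
    (hz2 : ∀ i, MemLp (fun ω => z ω i) 2 P)
    (hdet : IsUnit (secondMoment P (fun ω => (z ω).ofLp) (fun ω => (z ω).ofLp)).det)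
    {K : Fin nx ⊕ Fin nw → ℝ} (hK : K ⬝ᵥ Xi P x w z *ᵥ K ≠ 0)
    (hγ : ∀ ω, γ.1 (o ω) = Measure.dirac (K ⬝ᵥ stackXW x w ω)) :
    IsRegular P z o γ := by
  rw [isRegular_iff ho γ hz2 hdet, msgVar_joint_of_linear ho hx hw hz hx2 hw2 hz2 hγ]
  refine ⟨?_, hK⟩
  have h := (memLp_dotProduct_stackXW hx2 hw2 K).2
  rw [eLpNorm_lt_top_iff_lintegral_rpow_enorm_lt_top (by norm_num) (by norm_num)] at h
  simp only [ENNReal.toReal_ofNat, ENNReal.rpow_ofNat] at h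
  simpa [hγ] using h.ne

/-- A nonzero multiple of the message given by a minimal eigenvector, answered by linear
estimators, is an equilibrium. -/
theorem isEquilibrium_of_linear (hnx : 0 < nx) (ho : Measurable o) (hx : Measurable x)
    (hw : Measurable w) (hz : Measurable z)
    (hGauss : HasGaussianLaw (fun ω => (x ω, w ω, z ω)) P)
    (hx2 : ∀ i, MemLp (fun ω => x ω i) 2 P) (hw2 : ∀ i, MemLp (fun ω => w ω i) 2 P)
    (hz2 : ∀ i, MemLp (fun ω => z ω i) 2 P)
    (hx0 : ∀ i, ∫ ω, x ω i ∂P = 0) (hw0 : ∀ i, ∫ ω, w ω i ∂P = 0) (hz0 : ∀ i, ∫ ω, z ω i ∂P = 0)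
    (hdet : IsUnit (secondMoment P (fun ω => (z ω).ofLp) (fun ω => (z ω).ofLp)).det)
    (hXi : (Xi P x w z).PosDef) {ξ : Fin nx ⊕ Fin nw → ℝ}
    (hξ : IsNormalizedMinEigenvector (privacyMatrix (Xi P x w z) δ) ξ) {k : ℝ} (hk : k ≠ 0)
    (hγ : ∀ ω, γ.1 (o ω) =
      Measure.dirac ((k • (CFC.sqrt (Xi P x w z))⁻¹ *ᵥ ξ) ⬝ᵥ stackXW x w ω)) :
    IsRegular P z o γ ∧
      IsEquilibrium P x w z o δ (lmmsePolicy P x z o) (lmmsePolicy P w z o) γ := by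
  obtain ⟨hξ1, l, hl, hξl⟩ := hξ
  set R := CFC.sqrt (Xi P x w z) with hRdef
  have hu : IsUnit R.det := isUnit_det_sqrt hXi
  set K := k • R⁻¹ *ᵥ ξ with hK
  have hXK : Xi P x w z *ᵥ K = k • R *ᵥ ξ := by
    rw [hK, mulVec_smul, ← sqrt_mul_sqrt hXi, ← hRdef, mulVec_mulVec, Matrix.mul_assoc,
      mul_nonsing_inv _ hu, Matrix.mul_one]
  -- Normalization of `ξ` makes the residual variance of the message exactly `k²`.
  have hs : K ⬝ᵥ Xi P x w z *ᵥ K = k ^ 2 := by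
    rw [hXK, hK, smul_dotProduct, dotProduct_smul, dotProduct_mulVec_comm (isHermitian_sqrt _),
      ← hRdef, mulVec_mulVec, mul_nonsing_inv _ hu, one_mulVec, hξ1]
    simp [pow_two]
  have hk2 : k ^ 2 ≠ 0 := pow_ne_zero 2 hk
  have hreg := isRegular_of_linear ho hx hw hz hx2 hw2 hz2 hdet (hs ▸ hk2) hγ
  have hYm := measurable_dotProduct_stackXW hx hw K
  have hY2 := memLp_dotProduct_stackXW hx2 hw2 K
  have hY0 : ∫ ω, K ⬝ᵥ stackXW x w ω ∂P = 0 := by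
    simp only [dotProduct]
    rw [integral_finsetSum _ fun j _ =>
      ((memLp_stackXW hx2 hw2 j).integrable (by norm_num)).const_mul _]
    refine Finset.sum_eq_zero fun j _ => ?_
    rw [integral_const_mul]
    rcases j with j | j
    · simp [stackXW, hx0]
    · simp [stackXW, hw0]
  refine ⟨hreg, ?_, ?_, fun ψ' => ?_, fun φ' => ?_, fun γ' => ?_⟩
  · rw [(estError_lmmsePolicy_regular ho hx hz hx2 hz2 hdet hreg rfl).1]
    exact ENNReal.ofReal_ne_top
  · rw [(estError_lmmsePolicy_regular ho hw hz hw2 hz2 hdet hreg rfl).1]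
    exact ENNReal.ofReal_ne_top
  · exact estError_lmmsePolicy_le hx hz hYm hγ hreg
      (hasGaussianLaw_obs_dotProduct hGauss (LinearMap.fst ℝ _ _) K) hx2 hz2 hY2 hx0 hz0 hY0 _
  · exact estError_lmmsePolicy_le hw hz hYm hγ hreg
      (hasGaussianLaw_obs_dotProduct hGauss (LinearMap.fst ℝ _ _ ∘ₗ LinearMap.snd ℝ _ _) K)
      hw2 hz2 hY2 hw0 hz0 hY0 _
  -- The cost at `γ` equals the universal lower bound: the covariances are `k • R *ᵥ ξ`, whose form
  -- is `k² l`, and `k²` cancels against the variance.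
  · refine le_trans (le_of_eq ?_)
      (le_senderCost hnx ho hx hw hz hx2 hw2 hz2 hdet hXi hl.2 γ')
    rw [senderCost_regular ho hx hw hz hx2 hw2 hz2 hdet hreg,
      msgVar_joint_of_linear ho hx hw hz hx2 hw2 hz2 hγ,
      msgCov_joint_of_linear ho hx hw hz hx2 hw2 hz2 hγ, hs, hXK]
    have hform : privacyForm δ (k • R *ᵥ ξ) = k ^ 2 * l := by
      rw [← privacyForm_sqrt_mulVec hξ1 hξl, ← hRdef]
      simp only [privacyForm, Pi.smul_apply, smul_eq_mul, mul_pow, ← Finset.mul_sum]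
      ring
    rw [hform, mul_div_cancel_left₀ _ hk2]

end Equilibrium

end PrivacyGame

end

open PrivacyGame in
/-- `o` is what the sender observes: a random element that determines `(x, w)`, for instance
`o = (x, w)`, or `o = (x, w, z)` if the sender has access to the side information as well. -/
theorem corollary1
    {Ω I : Type*} [MeasurableSpace Ω] [MeasurableSpace I]
    (P : Measure Ω) [IsProbabilityMeasure P]
    {nx nw nz : ℕ} (hnx : 0 < nx)
    (x : Ω → Vec nx) (w : Ω → Vec nw) (z : Ω → Vec nz)
    (hx : Measurable x) (hw : Measurable w) (hz : Measurable z)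
    (hGauss : HasGaussianLaw (fun ω => (x ω, w ω, z ω)) P)
    (hmean : ∀ i, ∫ ω, stackXWZ x w z ω i ∂P = 0)
    (hcov : (secondMoment P (stackXWZ x w z) (stackXWZ x w z)).PosDef)
    (o : Ω → I) (ho : Measurable o)
    (p : I → Vec nx × Vec nw) (hp : Measurable p) (hpo : ∀ ω, p (o ω) = (x ω, w ω))
    (δ : ℝ) (hδ : 0 ≤ δ) :
    (∃ ξ, IsNormalizedMinEigenvector (privacyMatrix (Xi P x w z) δ) ξ) ∧
    ∀ ξ, IsNormalizedMinEigenvector (privacyMatrix (Xi P x w z) δ) ξ →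
      ∃ (ψ : Policy I ℝ → Policy (ℝ × Vec nz) (Vec nx))
        (φ : Policy I ℝ → Policy (ℝ × Vec nz) (Vec nw)) (γ : Policy I ℝ),
        IsEquilibrium P x w z o δ ψ φ γ ∧
        (∀ γ' : Policy I ℝ, ∀ᵐ ω ∂P, ∀ᵐ y ∂(γ'.1 (o ω)),
          ∀ᵐ xh ∂((ψ γ').1 (y, z ω)), xh = lmmse P x z o γ' (y, z ω)) ∧
        (∀ γ' : Policy I ℝ, ∀ᵐ ω ∂P, ∀ᵐ y ∂(γ'.1 (o ω)),
          ∀ᵐ wh ∂((φ γ').1 (y, z ω)), wh = lmmse P w z o γ' (y, z ω)) ∧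
        IsRegular P z o γ ∧
        (∀ᵐ ω ∂P, ∀ᵐ y ∂(γ.1 (o ω)),
          y = ((CFC.sqrt (Xi P x w z))⁻¹.mulVec ξ) ⬝ᵥ stackXW x w ω) ∧
        ∀ k : ℝ, k ≠ 0 → IsEquilibrium P x w z o δ ψ φ (scale k γ) := by
  have hx2 : ∀ i, MemLp (fun ω => x ω i) 2 P := fun i =>
    (hGauss.map_fun ((EuclideanSpace.proj i).comp (ContinuousLinearMap.fst ℝ _ _))).memLp_two
  have hw2 : ∀ i, MemLp (fun ω => w ω i) 2 P := fun i =>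
    (hGauss.map_fun ((EuclideanSpace.proj i).comp ((ContinuousLinearMap.fst ℝ _ _).comp
      (ContinuousLinearMap.snd ℝ _ _)))).memLp_two
  have hz2 : ∀ i, MemLp (fun ω => z ω i) 2 P := fun i =>
    (hGauss.map_fun ((EuclideanSpace.proj i).comp ((ContinuousLinearMap.snd ℝ _ _).comp
      (ContinuousLinearMap.snd ℝ _ _)))).memLp_two
  have hx0 : ∀ i, ∫ ω, x ω i ∂P = 0 := fun i => hmean (Sum.inl (Sum.inl i))
  have hw0 : ∀ i, ∫ ω, w ω i ∂P = 0 := fun i => hmean (Sum.inl (Sum.inr i))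
  have hz0 : ∀ i, ∫ ω, z ω i ∂P = 0 := fun i => hmean (Sum.inr i)
  have hblocks : secondMoment P (stackXWZ x w z) (stackXWZ x w z) =
      Matrix.fromBlocks (secondMoment P (stackXW x w) (stackXW x w))
        (secondMoment P (stackXW x w) fun ω => (z ω).ofLp)
        (secondMoment P (stackXW x w) fun ω => (z ω).ofLp).transpose
        (secondMoment P (fun ω => (z ω).ofLp) fun ω => (z ω).ofLp) := by
    rw [secondMoment_transpose]
    ext i j
    rcases i with i | i <;> rcases j with j | j <;> rfl
  have hdet : IsUnit (secondMoment P (fun ω => (z ω).ofLp) (fun ω => (z ω).ofLp)).det :=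
    isUnit_iff_ne_zero.2
      (hcov.submatrix (e := Sum.inr) Sum.inr_injective).det_pos.ne'
  have hXi : (Xi P x w z).PosDef := posDef_schurComplement (hblocks ▸ hcov)
  have : Nonempty (Fin nx ⊕ Fin nw) := ⟨Sum.inl ⟨0, hnx⟩⟩
  refine ⟨exists_isNormalizedMinEigenvector (isHermitian_privacyMatrix _ δ), fun ξ hξ => ?_⟩
  set K := (CFC.sqrt (Xi P x w z))⁻¹.mulVec ξ with hK
  -- Since `p` recovers `(x, w)` from `o`, the linear message is a measurable function of what the
  -- sender observes.
  have hm : Measurable fun i => K ⬝ᵥ Sum.elim (p i).1.ofLp (p i).2.ofLp := by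
    have h1 : Measurable fun i => (p i).1 := hp.fst
    have h2 : Measurable fun i => (p i).2 := hp.snd
    simp only [dotProduct, Fintype.sum_sum_type, Sum.elim_inl, Sum.elim_inr]
    fun_prop
  set γ : Policy I ℝ := ⟨Kernel.deterministic _ hm, inferInstance⟩ with hγdef
  have hγ : ∀ ω, γ.1 (o ω) = Measure.dirac (K ⬝ᵥ stackXW x w ω) := fun ω => by
    rw [hγdef, Kernel.deterministic_apply, hpo]
    rfl
  -- One statement for all `k ≠ 0` covers both `γ` itself (`k = 1`) and its rescalings.
  have heq : ∀ {k : ℝ} (_ : k ≠ 0) {γ' : Policy I ℝ}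
      (_ : ∀ ω, γ'.1 (o ω) = Measure.dirac ((k • K) ⬝ᵥ stackXW x w ω)),
      IsRegular P z o γ' ∧
        IsEquilibrium P x w z o δ (lmmsePolicy P x z o) (lmmsePolicy P w z o) γ' :=
    fun hk _ h => isEquilibrium_of_linear hnx ho hx hw hz hGauss hx2 hw2 hz2 hx0 hw0 hz0 hdet hXi
      hξ hk h
  obtain ⟨hreg, hequi⟩ := heq one_ne_zero (γ' := γ) (by simpa using hγ)
  refine ⟨lmmsePolicy P x z o, lmmsePolicy P w z o, γ, hequi, fun γ' => ?_, fun γ' => ?_, hreg,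
    ?_, fun k hk => ?_⟩
  · refine .of_forall fun ω => .of_forall fun y => ?_
    rw [lmmsePolicy_apply, ae_dirac_eq]
    rfl
  · refine .of_forall fun ω => .of_forall fun y => ?_
    rw [lmmsePolicy_apply, ae_dirac_eq]
    rfl
  · refine .of_forall fun ω => ?_
    rw [hγ, ae_dirac_eq]
    rfl
  · refine (heq hk fun ω => ?_).2
    rw [scale, Kernel.map_apply _ (measurable_const_mul k), hγ,
      Measure.map_dirac' (measurable_const_mul k), smul_dotProduct, smul_eq_mul]
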